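/- Let $\nu>0$, $\bar u_l>\bar u_r$, $p>0$, and let $w_0\in L^\infty(\mathbb R)$ be $p$-periodic with $\frac1p\int_0^p w_0\,dx=0$. Put $f(u)=u^2/2$ and $s=\frac{f(\bar u_l)-f(\bar u_r)}{\bar u_l-\bar u_r}$. Let $\phi$ be any shock profile with viscosity $1$, i.e. a $C^2$ solution of $\phi''=f'(\phi)\phi'-s\phi'$ on $\mathbb R$ with $\phi(-\infty)=\bar u_l$ and $\phi(+\infty)=\bar u_r$, and set $$\phi^\nu(x)=\phi(x/\nu),\qquad g^\nu(x)=\frac{\phi^\nu(x)-\bar u_r}{\bar u_l-\bar u_r}.$$ By a bounded solution of Burgers' equation $\partial_t u+\partial_x f(u)=\nu\,\partial_x^2u$ ($x\in\mathbb R$, $t>0$) with data $u(\cdot,0)=u_0$ we mean a function that is bounded and smooth for $t>0$, satisfies the equation there, and satisfies $\int_{\mathbb R}[\varphi(x,t)u(x,t)-\varphi(x,0)u_0(x)]\,dx\to0$ as $t\to0^+$ for every continuous compactly supported $\varphi$ on $\mathbb R\times[0,\infty)$. Let $u^\nu,u_l^\nu,u_r^\nu$ be the bounded solutions with data $\phi^\nu+w_0$,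 $\bar u_l+w_0$, $\bar u_r+w_0$ respectively, and for $\xi\in\mathbb R$ let $$\psi^\nu_\xi(x,t)=u_l^\nu(x,t)\,g^\nu(x-\xi)+u_r^\nu(x,t)\,\bigl(1-g^\nu(x-\xi)\bigr).$$ Let $t_k=\dfrac{kp}{\bar u_l-\bar u_r}$, $k=0,1,2,\dots$. Then: 1. For every $k\ge0$ and every $x\in\mathbb R$, $\;u^\nu(x,t_k)=\psi^\nu_{st_k}(x,t_k)$. 2. Let $T_0>0$ be such that $\frac{\bar u_l-\bar u_r}2<u_l^\nu(x,t)-u_r^\nu(x,t)<2(\bar u_l-\bar u_r)$ for all $x\in\mathbb R$, $t\ge T_0$, and let $X^\nu:[T_0,\infty)\to\mathbb R$ be the shift function, i.e. the continuous function that satisfies $\int_{\mathbb R}\bigl(u^\nu-\psi^\nu_{X^\nu(T_0)}\bigr)(x,T_0)\,dx=0$ and, for $t>T_0$, $(X^\nu)'(t)=F^\nu(X^\nu(t),t)$, where $$F^\nu(\xi,t)=\frac{\int_{\mathbb R}\bigl[\nu(u_l^\nu-u_r^\nu)(x,t)\,(g^\nu)''(x-\xi)+\bigl(f(u_l^\nu)-f(u_r^\nu)\bigr)(x,t)\,(g^\nu)'(x-\xi)\bigr]dx}{\int_{\mathbb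 R}(u_l^\nu-u_r^\nu)(x,t)\,(g^\nu)'(x-\xi)\,dx}.$$ Then $X^\nu(t_k)=s\,t_k$ for every $k$ with $t_k\ge T_0$. -/

import Mathlib

open MeasureTheory Filter Topology Set
open scoped ContDiff

namespace ViscousLaw

/-- The Burgers flux `f(u) = u ^ 2 / 2`. -/
noncomputable def burgersFlux (v : ℝ) : ℝ := v ^ 2 / 2

/-- `u` (written `u x t`) is a bounded solution of the Cauchy problem
`∂ₜ u + ∂ₓ f(u) = ν ∂ₓ² u` for `x ∈ ℝ`, `t > 0`, with `u(x, 0) = u₀(x)`: it is smooth and bounded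
for `t > 0`, satisfies the equation pointwise there, and attains the data in the weak sense. -/
structure IsBoundedSolution (f : ℝ → ℝ) (ν : ℝ) (u₀ : ℝ → ℝ) (u : ℝ → ℝ → ℝ) : Prop where
  smooth : ContDiffOn ℝ ∞ (fun z : ℝ × ℝ => u z.1 z.2) {z : ℝ × ℝ | 0 < z.2}
  bounded : ∃ M : ℝ, ∀ x t : ℝ, 0 < t → |u x t| ≤ M
  equation : ∀ x t : ℝ, 0 < t →
    deriv (fun τ => u x τ) t + deriv (fun y => f (u y t)) x
      = ν * iteratedDeriv 2 (fun y => u y t) x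
  initial_value : ∀ x : ℝ, u x 0 = u₀ x
  initial_weak : ∀ η : ℝ × ℝ → ℝ, Continuous η → HasCompactSupport η →
    Tendsto (fun t : ℝ => ∫ x : ℝ, (η (x, t) * u x t - η (x, 0) * u₀ x)) (𝓝[>] 0) (𝓝 0)

/-- The shock speed given by the Rankine-Hugoniot condition. -/
noncomputable def shockSpeed (f : ℝ → ℝ) (ul ur : ℝ) : ℝ := (f ul - f ur) / (ul - ur)

/-- `φ` is a viscous shock profile, for viscosity `ν`, joining `ul` at `-∞` to `ur` at `+∞`. -/
structure IsShockProfile (f : ℝ → ℝ) (ν ul ur : ℝ) (φ : ℝ → ℝ) : Prop where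
  contDiff : ContDiff ℝ 2 φ
  equation : ∀ x : ℝ,
    ν * iteratedDeriv 2 φ x = deriv f (φ x) * deriv φ x - shockSpeed f ul ur * deriv φ x
  limit_left : Tendsto φ atBot (𝓝 ul)
  limit_right : Tendsto φ atTop (𝓝 ur)

/-- `φ^ν(x) = φ(x / ν)`. -/
noncomputable def scaledProfile (φ : ℝ → ℝ) (ν : ℝ) (x : ℝ) : ℝ := φ (x / ν)

/-- `g^ν(x) = (φ^ν(x) - ur) / (ul - ur)`. -/
noncomputable def weight (φ : ℝ → ℝ) (ν ul ur : ℝ) (x : ℝ) : ℝ :=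
  (scaledProfile φ ν x - ur) / (ul - ur)

/-- The ansatz `ψ_ξ(x, t) = u_l(x, t) g(x - ξ) + u_r(x, t) (1 - g(x - ξ))`,
where `ξ` is the value of the shift at time `t`. -/
def ansatz (uL uR : ℝ → ℝ → ℝ) (g : ℝ → ℝ) (ξ x t : ℝ) : ℝ :=
  uL x t * g (x - ξ) + uR x t * (1 - g (x - ξ))

/-- The right-hand side `F(ξ, t)` of the differential equation for the shift. -/
noncomputable def shiftField (f : ℝ → ℝ) (ν : ℝ) (uL uR : ℝ → ℝ → ℝ) (g : ℝ → ℝ)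
    (ξ t : ℝ) : ℝ :=
  (∫ x : ℝ, (ν * (uL x t - uR x t) * iteratedDeriv 2 g (x - ξ)
      + (f (uL x t) - f (uR x t)) * deriv g (x - ξ)))
    / ∫ x : ℝ, (uL x t - uR x t) * deriv g (x - ξ)

/-- `T₀ > 0` is a time from which on `u_l - u_r` stays strictly between half of and twice
`ul - ur`. -/
def IsAdmissibleTime (ul ur : ℝ) (uL uR : ℝ → ℝ → ℝ) (T₀ : ℝ) : Prop :=
  0 < T₀ ∧ ∀ x t : ℝ, T₀ ≤ t →
    (ul - ur) / 2 < uL x t - uR x t ∧ uL x t - uR x t < 2 * (ul - ur)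

/-- `X` is a shift function on `[T₀, ∞)`: it solves `X'(t) = F(X(t), t)` for `t > T₀`, and its
value at `T₀` is such that the difference of `u` and the ansatz has zero mass at `T₀`. -/
structure IsShiftFunction (f : ℝ → ℝ) (ν : ℝ) (u uL uR : ℝ → ℝ → ℝ) (g : ℝ → ℝ)
    (T₀ : ℝ) (X : ℝ → ℝ) : Prop where
  continuousOn : ContinuousOn X (Ici T₀)
  zero_mass : ∫ x : ℝ, (u x T₀ - ansatz uL uR g (X T₀) x T₀) = 0
  equation : ∀ t : ℝ, T₀ < t → HasDerivAt X (shiftField f ν uL uR g (X t) t) t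

end ViscousLaw

namespace ViscousLaw

/-! The engine is the Cole-Hopf transform. A solution `u` of Burgers' equation has a potential `U`
with `U_x = u` and `U_t = ν u_x - u²/2`, and `exp(-U/(2ν))` then solves the heat equation. For the
shock profile, `exp(-∫φ^ν/(2ν))` equals `a e^{-ul x/(2ν)} + b e^{-ur x/(2ν)}` with `a, b > 0`.
Multiplying by `exp(-∫w₀/(2ν))` shows that the transform of `u` is, at time zero, `a` times that of
`uL` plus `b` times that of `uR`. Uniqueness for the heat equation among functions of exponential
growth (`IsHeatSolution.eq_of_initial_eq`) propagates this superposition to all times.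
Differentiating it in space gives `u` as a convex combination of `uL` and `uR`, whose weight is the
logistic function of `(UL - UR)/(2ν)`; `g^ν` is the same logistic function of `(ul - ur) x/(2ν)`
(`IsShockTriple.eq_logistic`, `IsShockProfile.exists_explicit`).

It remains to know `UL - UR`. With `c = ul - ur`, the Galilean boost by `c` carries `UR` to `UL`, so
`UL(x,t) = UR(x - ct, t) + cx - c²t/2`. Since `w₀` has zero mean, `UR` minus `ur x` is `p`-periodic
in `x`. When `ct = kp` the displacement is a whole number of periods, and `UL - UR` collapses to
`c(x - st)`. The weight is then exactly `g^ν(x - st)`, which is the first claim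
(`IsShockTriple.eq_ansatz`).

For the second claim, the excess mass of `u` over the ansatz with shift `ξ` is a constant plus `∫
(UL - UR)(y + ξ, t) g'(y) dy` (`IsShockTriple.integral_sub_ansatz`). The differential equation for
the shift says that this quantity is constant along `X` (`IsShockTriple.hasDerivAt_shiftMass_zero`),
so it stays zero. At a resonant time it also vanishes for `ξ = st`, by the first claim, and it is
affine in `ξ` with slope `-c`; hence `X(t) = st`. -/

lemma isOpen_upperHalf : IsOpen {z : ℝ × ℝ | 0 < z.2} := isOpen_lt continuous_const continuous_snd

/-! ### Calculus on the open half plane of positive times -/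

section Smooth

variable {f : ℝ → ℝ → ℝ} (hf : ContDiffOn ℝ ∞ (fun z : ℝ × ℝ => f z.1 z.2) {z : ℝ × ℝ | 0 < z.2})
include hf

lemma hasFDerivAt_of_smooth {z : ℝ × ℝ} (hz : 0 < z.2) :
    HasFDerivAt (fun z : ℝ × ℝ => f z.1 z.2) (fderiv ℝ (fun z : ℝ × ℝ => f z.1 z.2) z) z :=
  ((hf.contDiffAt (isOpen_upperHalf.mem_nhds hz)).differentiableAt (by simp)).hasFDerivAt

lemma hasDerivAt_fst_fderiv {x t : ℝ} (ht : 0 < t) :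
    HasDerivAt (fun y => f y t) (fderiv ℝ (fun z : ℝ × ℝ => f z.1 z.2) (x, t) (1, 0)) x := by
  have h := (hasFDerivAt_of_smooth hf (z := (x, t)) ht).comp_hasDerivAt x
    ((hasDerivAt_id x).prodMk (hasDerivAt_const x t))
  simpa [Function.comp_def] using h

lemma hasDerivAt_snd_fderiv {x t : ℝ} (ht : 0 < t) :
    HasDerivAt (fun τ => f x τ) (fderiv ℝ (fun z : ℝ × ℝ => f z.1 z.2) (x, t) (0, 1)) t := by
  have h := (hasFDerivAt_of_smooth hf (z := (x, t)) ht).comp_hasDerivAt t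
    ((hasDerivAt_const t x).prodMk (hasDerivAt_id t))
  simpa [Function.comp_def] using h

lemma hasDerivAt_fst {x t : ℝ} (ht : 0 < t) :
    HasDerivAt (fun y => f y t) (deriv (fun y => f y t) x) x :=
  (hasDerivAt_fst_fderiv hf ht).differentiableAt.hasDerivAt

lemma hasDerivAt_snd {x t : ℝ} (ht : 0 < t) :
    HasDerivAt (fun τ => f x τ) (deriv (fun τ => f x τ) t) t :=
  (hasDerivAt_snd_fderiv hf ht).differentiableAt.hasDerivAt

lemma smooth_deriv_fst :
    ContDiffOn ℝ ∞ (fun z : ℝ × ℝ => deriv (fun y => f y z.2) z.1) {z : ℝ × ℝ | 0 < z.2} := by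
  have h : ContDiffOn ℝ ∞ (fun z : ℝ × ℝ => fderiv ℝ (fun z : ℝ × ℝ => f z.1 z.2) z (1, 0))
      {z : ℝ × ℝ | 0 < z.2} :=
    (hf.fderiv_of_isOpen isOpen_upperHalf (by simp)).clm_apply contDiffOn_const
  exact h.congr fun z hz => (hasDerivAt_fst_fderiv hf hz).deriv

lemma smooth_deriv_snd :
    ContDiffOn ℝ ∞ (fun z : ℝ × ℝ => deriv (fun τ => f z.1 τ) z.2) {z : ℝ × ℝ | 0 < z.2} := by
  have h : ContDiffOn ℝ ∞ (fun z : ℝ × ℝ => fderiv ℝ (fun z : ℝ × ℝ => f z.1 z.2) z (0, 1))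
      {z : ℝ × ℝ | 0 < z.2} :=
    (hf.fderiv_of_isOpen isOpen_upperHalf (by simp)).clm_apply contDiffOn_const
  exact h.congr fun z hz => (hasDerivAt_snd_fderiv hf hz).deriv

end Smooth

lemma continuous_slice {f : ℝ → ℝ → ℝ}
    (hf : ContinuousOn (fun z : ℝ × ℝ => f z.1 z.2) {z : ℝ × ℝ | 0 < z.2}) {t : ℝ} (ht : 0 < t) :
    Continuous (fun x => f x t) :=
  hf.comp_continuous (f := fun x : ℝ => (x, t)) (by fun_prop) (fun _ => ht)

/-- Differentiation under the integral sign for integrands that are `C¹` for positive times. -/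
lemma hasDerivAt_intervalIntegral_param {f f' : ℝ → ℝ → ℝ}
    (hf : ContinuousOn (fun z : ℝ × ℝ => f z.1 z.2) {z : ℝ × ℝ | 0 < z.2})
    (hf' : ContinuousOn (fun z : ℝ × ℝ => f' z.1 z.2) {z : ℝ × ℝ | 0 < z.2})
    (hd : ∀ x t, 0 < t → HasDerivAt (fun τ => f x τ) (f' x t) t) (a b : ℝ) {t : ℝ} (ht : 0 < t) :
    HasDerivAt (fun τ => ∫ x in a..b, f x τ) (∫ x in a..b, f' x t) t := by
  have hK : IsCompact (uIcc a b ×ˢ Icc (t / 2) (2 * t)) := isCompact_uIcc.prod isCompact_Icc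
  have hsub : uIcc a b ×ˢ Icc (t / 2) (2 * t) ⊆ {z : ℝ × ℝ | 0 < z.2} := by
    rintro ⟨x, τ⟩ ⟨-, h1, -⟩
    have : t / 2 ≤ τ := h1
    show 0 < τ
    linarith
  obtain ⟨C, hC⟩ := hK.exists_bound_of_continuousOn (hf'.mono hsub)
  have hs : Icc (t / 2) (2 * t) ∈ 𝓝 t := Icc_mem_nhds (by linarith) (by linarith)
  refine (intervalIntegral.hasDerivAt_integral_of_dominated_loc_of_deriv_le (μ := volume)
    (F := fun τ x => f x τ) (F' := fun τ x => f' x τ)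
    (bound := fun _ => C) hs ?_ ?_ ?_ ?_ ?_ ?_).2
  · filter_upwards [hs] with τ hτ
    exact (continuous_slice hf (by linarith [hτ.1])).aestronglyMeasurable
  · exact (continuous_slice hf ht).intervalIntegrable _ _
  · exact (continuous_slice hf' ht).aestronglyMeasurable
  · refine Eventually.of_forall fun x hx τ hτ => ?_
    exact hC (x, τ) ⟨uIoc_subset_uIcc hx, hτ⟩
  · exact intervalIntegrable_const
  · refine Eventually.of_forall fun x hx τ hτ => ?_
    exact hd x τ (by linarith [hτ.1])

/-! ### Weak attainment of the initial data -/

/-- A continuous cutoff in time which is `1` for `|t| ≤ 1`. -/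
lemma exists_time_cutoff : ∃ χ : ℝ → ℝ, Continuous χ ∧ HasCompactSupport χ ∧
    ∀ t, |t| ≤ 1 → χ t = 1 := by
  refine ⟨fun t => max 0 (min 1 (2 - |t|)), by fun_prop, ?_, ?_⟩
  · refine HasCompactSupport.intro (isCompact_Icc (a := -2) (b := (2 : ℝ))) fun t ht => ?_
    have : 2 < |t| := by
      by_contra! h
      exact ht (abs_le.1 h)
    exact max_eq_left ((min_le_right _ _).trans (by linarith))
  · intro t ht
    simp only
    rw [min_eq_left (by linarith), max_eq_right (by norm_num)]

section Weak

variable {f : ℝ → ℝ} {ν : ℝ} {u₀ : ℝ → ℝ} {u : ℝ → ℝ → ℝ}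

lemma IsBoundedSolution.continuousOn (hu : IsBoundedSolution f ν u₀ u) :
    ContinuousOn (fun z : ℝ × ℝ => u z.1 z.2) {z : ℝ × ℝ | 0 < z.2} := hu.smooth.continuousOn

/-- The initial data are attained when tested against any integrable function of `x`. -/
lemma IsBoundedSolution.tendsto_integral_mul (hu : IsBoundedSolution f ν u₀ u)
    (hm : AEStronglyMeasurable u₀ volume) {M₀ : ℝ} (hM₀ : ∀ᵐ x, |u₀ x| ≤ M₀)
    {K : ℝ → ℝ} (hK : Integrable K) :
    Tendsto (fun t : ℝ => ∫ x, K x * u x t) (𝓝[>] 0) (𝓝 (∫ x, K x * u₀ x)) := by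
  obtain ⟨M, hM⟩ := hu.bounded
  obtain ⟨χ, hχc, hχs, hχ1⟩ := exists_time_cutoff
  have hut : ∀ t, 0 < t → AEStronglyMeasurable (fun x => u x t) volume := fun t ht =>
    (continuous_slice hu.continuousOn ht).aestronglyMeasurable
  have hM0 : 0 ≤ M := (abs_nonneg _).trans (hM 0 1 one_pos)
  have hM₀0 : 0 ≤ M₀ := by
    obtain ⟨x, hx⟩ := hM₀.exists
    exact (abs_nonneg _).trans hx
  have hi : ∀ {g : ℝ → ℝ}, Integrable g → ∀ t, 0 < t → Integrable (fun x => g x * u x t) :=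
    fun hg t ht => hg.mul_bdd (hut t ht) (Eventually.of_forall fun x => hM x t ht)
  have hi₀ : ∀ {g : ℝ → ℝ}, Integrable g → Integrable (fun x => g x * u₀ x) :=
    fun hg => hg.mul_bdd hm hM₀
  rw [Metric.tendsto_nhds]
  intro ε hε
  -- Continuous compactly supported functions are dense in `L¹`. Replacing `K` by such an `η` with
  -- `L¹` error `δ` costs at most `δ (M + M₀) ≤ ε/2`, uniformly in `t`.
  set δ := ε / (2 * (M + M₀ + 1)) with hδ
  have hδ0 : 0 < δ := by positivity
  obtain ⟨η, hηs, hηK, hηc, hηi⟩ := hK.exists_hasCompactSupport_integral_sub_le hδ0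
  have hw := hu.initial_weak (fun z => η z.1 * χ z.2) (by fun_prop) (by
    refine HasCompactSupport.intro (hηs.isCompact.prod hχs.isCompact) fun z hz => ?_
    by_cases h1 : z.1 ∈ tsupport η
    · have h2 : z.2 ∉ tsupport χ := fun h2 => hz ⟨h1, h2⟩
      simp [image_eq_zero_of_notMem_tsupport h2]
    · simp [image_eq_zero_of_notMem_tsupport h1])
  rw [Metric.tendsto_nhds] at hw
  have h01 : ∀ᶠ t : ℝ in 𝓝[>] 0, t < 1 := nhdsWithin_le_nhds (Iio_mem_nhds one_pos)
  filter_upwards [hw (ε / 2) (by positivity), h01, self_mem_nhdsWithin] with t ht ht1 ht0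
  have ht0 : 0 < t := ht0
  rw [Real.dist_eq, sub_zero] at ht
  simp only [hχ1 t (by rw [abs_of_pos ht0]; exact ht1.le), hχ1 0 (by simp), mul_one] at ht
  have e1 : (∫ x, K x * u x t) - ∫ x, K x * u₀ x
      = (∫ x, (η x * u x t - η x * u₀ x)) + ∫ x, (K x - η x) * (u x t - u₀ x) := by
    have hd : Integrable (fun x => K x - η x) := hK.sub hηi
    have hs : Integrable (fun x => (K x - η x) * (u x t - u₀ x)) := by
      have := (hi hd t ht0).sub (hi₀ hd)
      refine this.congr (Eventually.of_forall fun x => ?_)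
      simp only [Pi.sub_apply]; ring
    have hη : Integrable (fun x => η x * u x t - η x * u₀ x) := (hi hηi t ht0).sub (hi₀ hηi)
    rw [← integral_sub (hi hK t ht0) (hi₀ hK), ← integral_add hη hs]
    congr 1; ext x; ring
  have e2 : |∫ x, (K x - η x) * (u x t - u₀ x)| ≤ δ * (M + M₀) := by
    calc |∫ x, (K x - η x) * (u x t - u₀ x)| ≤ ∫ x, ‖K x - η x‖ * (M + M₀) := by
          have hd : Integrable (fun x => K x - η x) := hK.sub hηi
          refine norm_integral_le_of_norm_le (f := fun x => (K x - η x) * (u x t - u₀ x))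
            (g := fun x => ‖K x - η x‖ * (M + M₀)) (hd.norm.mul_const _) ?_
          filter_upwards [hM₀] with x hx
          rw [norm_mul]
          refine mul_le_mul_of_nonneg_left ?_ (norm_nonneg _)
          exact (abs_sub _ _).trans (add_le_add (hM x t ht0) hx)
      _ = (∫ x, ‖K x - η x‖) * (M + M₀) := integral_mul_const _ _
      _ ≤ δ * (M + M₀) := mul_le_mul_of_nonneg_right hηK (by positivity)
  have e3 : δ * (M + M₀) ≤ ε / 2 := by
    rw [hδ, div_mul_eq_mul_div, div_le_div_iff₀ (by positivity) (by positivity)]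
    nlinarith
  rw [Real.dist_eq, e1]
  calc _ ≤ _ := abs_add_le _ _
    _ < ε := by linarith

/-- A sharp cutoff to an interval is an admissible integrable weight. This yields the initial values
of the integrals that make up `potential`. -/
lemma IsBoundedSolution.tendsto_intervalIntegral_mul (hu : IsBoundedSolution f ν u₀ u)
    (hm : AEStronglyMeasurable u₀ volume) {M₀ : ℝ} (hM₀ : ∀ᵐ x, |u₀ x| ≤ M₀)
    {k : ℝ → ℝ} (hk : Continuous k) (a b : ℝ) :
    Tendsto (fun t : ℝ => ∫ x in a..b, k x * u x t) (𝓝[>] 0) (𝓝 (∫ x in a..b, k x * u₀ x)) := by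
  have key : ∀ a b : ℝ, Tendsto (fun t : ℝ => ∫ x in Ioc a b, k x * u x t) (𝓝[>] 0)
      (𝓝 (∫ x in Ioc a b, k x * u₀ x)) := by
    intro a b
    have hK : Integrable ((Ioc a b).indicator k) :=
      (integrable_indicator_iff measurableSet_Ioc).2
        ((hk.integrableOn_Icc (a := a) (b := b)).mono_set Ioc_subset_Icc_self)
    have := hu.tendsto_integral_mul hm hM₀ hK
    have e : ∀ v : ℝ → ℝ, ∫ x, (Ioc a b).indicator k x * v x = ∫ x in Ioc a b, k x * v x := by
      intro v
      rw [← integral_indicator measurableSet_Ioc]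
      congr 1; ext x
      by_cases hx : x ∈ Ioc a b <;> simp [hx]
    simpa only [e] using this
  exact (key a b).sub (key b a)

end Weak

/-! ### Potentials of solutions of Burgers' equation -/

/-- The derivative in time of a potential of a solution `u` of Burgers' equation. -/
noncomputable def burgersRate (ν : ℝ) (u : ℝ → ℝ → ℝ) (x t : ℝ) : ℝ :=
  ν * deriv (fun y => u y t) x - u x t ^ 2 / 2

/-- `U` is a potential of the solution `u` of Burgers' equation, with initial values `U₀`. -/
structure IsPotential (ν : ℝ) (u : ℝ → ℝ → ℝ) (U₀ : ℝ → ℝ) (U : ℝ → ℝ → ℝ) : Prop where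
  differentiable : ∀ x t, 0 < t → DifferentiableAt ℝ (fun y => u y t) x
  hasFDerivAt : ∀ x t, 0 < t → HasFDerivAt (fun z : ℝ × ℝ => U z.1 z.2)
    (u x t • ContinuousLinearMap.fst ℝ ℝ ℝ + burgersRate ν u x t • ContinuousLinearMap.snd ℝ ℝ ℝ)
    (x, t)
  continuousOn : ContinuousOn (fun z : ℝ × ℝ => U z.1 z.2) {z : ℝ × ℝ | 0 ≤ z.2}
  initial : ∀ x, U x 0 = U₀ x
  growth : ∀ T, ∃ C, ∀ x t, 0 ≤ t → t ≤ T → |U x t| ≤ C * (1 + |x|)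

section Construction

variable {ν : ℝ} {u₀ : ℝ → ℝ} {u : ℝ → ℝ → ℝ}

/-- Burgers' equation in conservation form: it says that the form `u dx + burgersRate dt` is closed,
which is why a potential exists. -/
lemma IsBoundedSolution.deriv_snd_eq (hu : IsBoundedSolution burgersFlux ν u₀ u) {x t : ℝ}
    (ht : 0 < t) :
    HasDerivAt (fun y => burgersRate ν u y t) (deriv (fun τ => u x τ) t) x := by
  have h1 := hasDerivAt_fst hu.smooth (x := x) ht
  have h2 := hasDerivAt_fst (f := fun x t => deriv (fun y => u y t) x)
    (smooth_deriv_fst hu.smooth) (x := x) ht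
  have h3 : HasDerivAt (fun y => burgersFlux (u y t)) (u x t * deriv (fun y => u y t) x) x := by
    have := (h1.pow 2).div_const 2
    refine HasDerivAt.congr_deriv (f := fun y => burgersFlux (u y t)) this ?_
    push_cast; ring
  have h4 := hu.equation x t ht
  rw [h3.deriv, iteratedDeriv_succ, iteratedDeriv_one] at h4
  have h5 := (h2.const_mul ν).sub h3
  rw [← h4] at h5
  exact h5.congr_deriv (by ring)

lemma IsBoundedSolution.continuousOn_burgersRate (hu : IsBoundedSolution burgersFlux ν u₀ u) :
    ContinuousOn (fun z : ℝ × ℝ => burgersRate ν u z.1 z.2) {z : ℝ × ℝ | 0 < z.2} :=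
  ((smooth_deriv_fst hu.smooth).continuousOn.const_smul ν).sub
    ((hu.continuousOn.pow 2).div_const 2)

/-- The rate of change of the average of the potential over `[0, 1]`. -/
noncomputable def averageRate (ν : ℝ) (u : ℝ → ℝ → ℝ) (t : ℝ) : ℝ :=
  ν * (u 1 t - u 0 t) - ∫ x in (0 : ℝ)..1, u x t ^ 2 / 2

/-- The potential of `u` that is normalised by `U(0, 0) = 0`. -/
noncomputable def potential (ν : ℝ) (u₀ : ℝ → ℝ) (u : ℝ → ℝ → ℝ) (x t : ℝ) : ℝ :=
  if 0 < t then (∫ τ in (0 : ℝ)..t, averageRate ν u τ) + (∫ z in (0 : ℝ)..x, u z t)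
    - (∫ z in (0 : ℝ)..1, (1 - z) * u z t) + ∫ z in (0 : ℝ)..1, (1 - z) * u₀ z
  else ∫ z in (0 : ℝ)..x, u₀ z

lemma IsBoundedSolution.continuousOn_averageRate (hu : IsBoundedSolution burgersFlux ν u₀ u) :
    ContinuousOn (averageRate ν u) (Ioi 0) := by
  have hs := hu.smooth
  have h1 : ∀ x, ContinuousOn (fun t => u x t) (Ioi 0) := fun x t ht =>
    (hasDerivAt_snd hs ht).continuousAt.continuousWithinAt
  refine (((h1 1).sub (h1 0)).const_smul ν).sub ?_
  intro t ht
  have hs2 : ContDiffOn ℝ ∞ (fun z : ℝ × ℝ => u z.1 z.2 ^ 2 / 2) {z : ℝ × ℝ | 0 < z.2} :=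
    (hs.pow 2).div_const 2
  exact (hasDerivAt_intervalIntegral_param (f := fun x t => u x t ^ 2 / 2) hs2.continuousOn
    (smooth_deriv_snd hs2 (f := fun x t => u x t ^ 2 / 2)).continuousOn
    (fun x t ht => hasDerivAt_snd hs2 (f := fun x t => u x t ^ 2 / 2) ht)
    0 1 ht).continuousAt.continuousWithinAt

/-- The pointwise rate contains `u_x`, for which no bound as `t → 0` is at hand. Averaging over `[0,
1]` turns `u_x` into a difference of values of `u`, so the averaged rate is bounded and can be
integrated from time zero. -/
lemma IsBoundedSolution.bound_averageRate (hν : 0 < ν) {M : ℝ}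
    (hM : ∀ x t : ℝ, 0 < t → |u x t| ≤ M) {t : ℝ} (ht : 0 < t) :
    |averageRate ν u t| ≤ ν * (2 * M) + M ^ 2 / 2 := by
  have h1 : |ν * (u 1 t - u 0 t)| ≤ ν * (2 * M) := by
    rw [abs_mul, abs_of_pos hν]
    refine mul_le_mul_of_nonneg_left ?_ hν.le
    exact (abs_sub _ _).trans (by linarith [hM 1 t ht, hM 0 t ht])
  have h2 : |∫ x in (0 : ℝ)..1, u x t ^ 2 / 2| ≤ M ^ 2 / 2 := by
    have := intervalIntegral.norm_integral_le_of_norm_le_const (a := 0) (b := 1)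
      (f := fun x => u x t ^ 2 / 2) (C := M ^ 2 / 2) fun x _ => by
        rw [Real.norm_of_nonneg (by positivity)]
        have := sq_le_sq' (abs_le.1 (hM x t ht)).1 (abs_le.1 (hM x t ht)).2
        linarith
    rwa [sub_zero, abs_one, mul_one] at this
  exact (abs_sub _ _).trans (add_le_add h1 h2)

lemma IsBoundedSolution.intervalIntegrable_averageRate (hν : 0 < ν)
    (hu : IsBoundedSolution burgersFlux ν u₀ u) {t : ℝ} (ht : 0 ≤ t) :
    IntervalIntegrable (averageRate ν u) volume 0 t := by
  obtain ⟨M, hM⟩ := hu.bounded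
  rw [intervalIntegrable_iff_integrableOn_Ioc_of_le ht]
  refine Integrable.of_bound (C := ν * (2 * M) + M ^ 2 / 2) ?_ ?_
  · exact (hu.continuousOn_averageRate.mono Ioc_subset_Ioi_self).aestronglyMeasurable
      measurableSet_Ioc
  · exact (ae_restrict_iff' measurableSet_Ioc).2 (Eventually.of_forall fun τ hτ =>
      bound_averageRate hν hM hτ.1)

lemma IsBoundedSolution.abs_integral_averageRate_le (hν : 0 < ν) {M : ℝ}
    (hM : ∀ x t : ℝ, 0 < t → |u x t| ≤ M) {t : ℝ} (ht : 0 ≤ t) :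
    |∫ τ in (0 : ℝ)..t, averageRate ν u τ| ≤ (ν * (2 * M) + M ^ 2 / 2) * t := by
  have := intervalIntegral.norm_integral_le_of_norm_le_const (a := 0) (b := t)
      (f := averageRate ν u) (C := ν * (2 * M) + M ^ 2 / 2) fun τ hτ => by
        rw [uIoc_of_le ht] at hτ
        exact bound_averageRate hν hM hτ.1
  simpa [abs_of_nonneg ht] using this

lemma IsBoundedSolution.hasDerivAt_potential_fst (hu : IsBoundedSolution burgersFlux ν u₀ u)
    {x t : ℝ} (ht : 0 < t) : HasDerivAt (fun y => potential ν u₀ u y t) (u x t) x := by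
  simp only [potential, if_pos ht]
  have hc := continuous_slice hu.continuousOn ht
  have := intervalIntegral.integral_hasDerivAt_right (hc.intervalIntegrable 0 x)
    (hc.stronglyMeasurableAtFilter _ _) hc.continuousAt
  exact ((this.const_add _).sub_const _).add_const _

/-- The mean over `[0, 1]` of `∫_0^x u` is `∫_0^1 (1 - z) u`; subtracting it leaves a potential
whose mean moves at `averageRate`. By conservation the three moving terms have derivatives
`averageRate`, `rate(x) - rate(0)` and `averageRate - rate(0)`, which combine to `rate(x)`. -/
lemma IsBoundedSolution.hasDerivAt_potential_snd (hν : 0 < ν)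
    (hu : IsBoundedSolution burgersFlux ν u₀ u)
    {x t : ℝ} (ht : 0 < t) :
    HasDerivAt (fun τ => potential ν u₀ u x τ) (burgersRate ν u x t) t := by
  have hs := hu.smooth
  have hc := continuous_slice hu.continuousOn ht
  have hut := (smooth_deriv_snd hs).continuousOn
  have hcut := continuous_slice (f := fun x t => deriv (fun τ => u x τ) t) hut ht
  have hcq := continuous_slice hu.continuousOn_burgersRate ht
  have hcont : ContinuousOn (fun z : ℝ × ℝ => (1 - z.1)) {z : ℝ × ℝ | 0 < z.2} := by fun_prop
  have hA : HasDerivAt (fun τ => ∫ τ in (0 : ℝ)..τ, averageRate ν u τ) (averageRate ν u t) t :=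
    intervalIntegral.integral_hasDerivAt_right (hu.intervalIntegrable_averageRate hν ht.le)
      (hu.continuousOn_averageRate.stronglyMeasurableAtFilter isOpen_Ioi _ ht)
      (hu.continuousOn_averageRate.continuousAt (Ioi_mem_nhds ht))
  have hB := hasDerivAt_intervalIntegral_param hu.continuousOn hut
    (fun x t ht => hasDerivAt_snd hs ht) 0 x ht
  have hC := hasDerivAt_intervalIntegral_param (f := fun x t => (1 - x) * u x t)
    (f' := fun x t => (1 - x) * deriv (fun τ => u x τ) t) (hcont.mul hu.continuousOn)
    (hcont.mul hut) (fun x t ht => (hasDerivAt_snd hs ht).const_mul _) 0 1 ht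
  have hB' : ∫ y in (0 : ℝ)..x, deriv (fun τ => u y τ) t
      = burgersRate ν u x t - burgersRate ν u 0 t :=
    intervalIntegral.integral_eq_sub_of_hasDerivAt (fun y _ => hu.deriv_snd_eq ht)
      (hcut.intervalIntegrable _ _)
  have hC' : ∫ y in (0 : ℝ)..1, (1 - y) * deriv (fun τ => u y τ) t
      = averageRate ν u t - burgersRate ν u 0 t := by
    rw [intervalIntegral.integral_mul_deriv_eq_deriv_mul (u := fun y => 1 - y)
      (u' := fun _ => -1) (v := fun y => burgersRate ν u y t)
      (fun y _ => (hasDerivAt_id y).const_sub 1)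
      (fun y _ => hu.deriv_snd_eq ht) (by simp) (hcut.intervalIntegrable _ _)]
    have hcx := continuous_slice (f := fun x t => deriv (fun y => u y t) x)
      (smooth_deriv_fst hs).continuousOn ht
    have h1 : ∫ y in (0 : ℝ)..1, deriv (fun y => u y t) y = u 1 t - u 0 t :=
      intervalIntegral.integral_eq_sub_of_hasDerivAt (fun y _ => hasDerivAt_fst hs ht)
        (hcx.intervalIntegrable _ _)
    have h2 : ∫ y in (0 : ℝ)..1, burgersRate ν u y t = averageRate ν u t := by
      unfold burgersRate averageRate
      have i1 : Continuous (fun y => ν * deriv (fun y => u y t) y) := by fun_prop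
      have i2 : Continuous (fun y => u y t ^ 2 / 2) := by fun_prop
      rw [intervalIntegral.integral_sub (i1.intervalIntegrable _ _)
        (i2.intervalIntegrable _ _), intervalIntegral.integral_const_mul, h1]
    simp only [sub_self, zero_mul, sub_zero, one_mul, neg_one_mul, intervalIntegral.integral_neg,
      h2]
    ring
  have key := ((hA.add hB).sub hC).add_const (∫ z in (0 : ℝ)..1, (1 - z) * u₀ z)
  rw [hB', hC'] at key
  refine (key.congr_deriv (by ring)).congr_of_eventuallyEq ?_
  filter_upwards [Ioi_mem_nhds ht] with τ hτ
  simp only [potential, if_pos (mem_Ioi.1 hτ), Pi.add_apply, Pi.sub_apply]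

lemma IsBoundedSolution.tendsto_potential (hν : 0 < ν)
    (hu : IsBoundedSolution burgersFlux ν u₀ u)
    (hm : AEStronglyMeasurable u₀ volume) {M₀ : ℝ} (hM₀ : ∀ᵐ x, |u₀ x| ≤ M₀) (x : ℝ) :
    Tendsto (fun t => potential ν u₀ u x t) (𝓝[>] 0) (𝓝 (∫ z in (0 : ℝ)..x, u₀ z)) := by
  obtain ⟨M, hM⟩ := hu.bounded
  have h1 : Tendsto (fun t => ∫ τ in (0 : ℝ)..t, averageRate ν u τ) (𝓝[>] 0) (𝓝 0) := by
    have h0 : Tendsto (fun t : ℝ => (ν * (2 * M) + M ^ 2 / 2) * t) (𝓝[>] 0) (𝓝 0) := by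
      have : Continuous (fun t : ℝ => (ν * (2 * M) + M ^ 2 / 2) * t) := by fun_prop
      simpa using (this.tendsto 0).mono_left nhdsWithin_le_nhds
    refine squeeze_zero_norm' ?_ h0
    filter_upwards [self_mem_nhdsWithin] with t ht
    exact abs_integral_averageRate_le hν hM (le_of_lt ht)
  have h2 := hu.tendsto_intervalIntegral_mul hm hM₀ (k := fun _ => 1) continuous_const 0 x
  have h3 := hu.tendsto_intervalIntegral_mul hm hM₀ (k := fun z => 1 - z) (by fun_prop) 0 1
  simp only [one_mul] at h2
  have key := ((h1.add h2).sub h3).add_const (∫ z in (0 : ℝ)..1, (1 - z) * u₀ z)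
  rw [zero_add, sub_add_cancel] at key
  refine key.congr' ?_
  filter_upwards [self_mem_nhdsWithin] with t ht
  simp only [potential, if_pos (mem_Ioi.1 ht)]

lemma abs_intervalIntegral_sub_le {v : ℝ → ℝ} (hm : AEStronglyMeasurable v volume) {M : ℝ}
    (hM : ∀ᵐ x, |v x| ≤ M) (x y : ℝ) :
    |(∫ z in (0 : ℝ)..x, v z) - ∫ z in (0 : ℝ)..y, v z| ≤ M * |x - y| := by
  have hi : ∀ a b, IntervalIntegrable v volume a b := fun a b =>
    (intervalIntegrable_const (c := M)).mono_fun hm.restrict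
      ((ae_restrict_of_ae hM).mono fun z hz => hz.trans (le_abs_self M))
  rw [intervalIntegral.integral_interval_sub_left (hi _ _) (hi _ _)]
  exact intervalIntegral.norm_integral_le_of_norm_le_const_ae (f := v) (hM.mono fun z hz _ => hz)

lemma IsBoundedSolution.abs_potential_sub_le (hu : IsBoundedSolution burgersFlux ν u₀ u)
    (hm : AEStronglyMeasurable u₀ volume) {M M₀ : ℝ} (hM : ∀ x t : ℝ, 0 < t → |u x t| ≤ M)
    (hM₀ : ∀ᵐ x, |u₀ x| ≤ M₀) (x y : ℝ) {t : ℝ} :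
    |potential ν u₀ u x t - potential ν u₀ u y t| ≤ max M M₀ * |x - y| := by
  unfold potential
  split_ifs with ht
  · have := abs_intervalIntegral_sub_le
      (continuous_slice hu.continuousOn ht).aestronglyMeasurable
      (Eventually.of_forall fun x => hM x t ht) x y
    refine le_trans (le_of_eq ?_) (this.trans
      (mul_le_mul_of_nonneg_right (le_max_left _ _) (abs_nonneg _)))
    congr 1; ring
  · exact (abs_intervalIntegral_sub_le hm hM₀ x y).trans
      (mul_le_mul_of_nonneg_right (le_max_right _ _) (abs_nonneg _))

/-- Every bounded solution of Burgers' equation has a potential. -/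
theorem IsBoundedSolution.isPotential (hν : 0 < ν)
    (hu : IsBoundedSolution burgersFlux ν u₀ u)
    (hm : AEStronglyMeasurable u₀ volume) {M₀ : ℝ} (hM₀ : ∀ᵐ x, |u₀ x| ≤ M₀) :
    IsPotential ν u (fun x => ∫ z in (0 : ℝ)..x, u₀ z) (potential ν u₀ u) := by
  obtain ⟨M, hM⟩ := hu.bounded
  have hsnd : ∀ x, ContinuousOn (fun t => potential ν u₀ u x t) (Ici 0) := by
    intro x t ht
    rcases eq_or_lt_of_le (mem_Ici.1 ht) with rfl | h
    · rw [← continuousWithinAt_Ioi_iff_Ici]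
      have := hu.tendsto_potential hν hm hM₀ x
      simpa [ContinuousWithinAt, potential] using this
    · exact (hu.hasDerivAt_potential_snd hν h).continuousAt.continuousWithinAt
  refine ⟨fun x t ht => (hasDerivAt_fst hu.smooth ht).differentiableAt, ?_, ?_, ?_, ?_⟩
  · intro x t ht
    have hn : ∀ᶠ v : ℝ × ℝ in 𝓝 (x, t), 0 < v.2 :=
      isOpen_upperHalf.mem_nhds (show (x, t) ∈ {z : ℝ × ℝ | 0 < z.2} from ht)
    have hcu := hu.continuousOn.continuousAt (isOpen_upperHalf.mem_nhds
      (show (x, t) ∈ {z : ℝ × ℝ | 0 < z.2} from ht))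
    have hcq := hu.continuousOn_burgersRate.continuousAt (isOpen_upperHalf.mem_nhds
      (show (x, t) ∈ {z : ℝ × ℝ | 0 < z.2} from ht))
    -- Both partial derivatives exist near the point and are continuous there, which gives joint
    -- differentiability.
    have := (hasStrictFDerivAt_uncurry_coprod (𝕜 := ℝ) (u := (x, t)) (f := potential ν u₀ u)
      (f₁ := fun x t => ContinuousLinearMap.toSpanSingleton ℝ (u x t))
      (f₂ := fun x t => ContinuousLinearMap.toSpanSingleton ℝ (burgersRate ν u x t))
      (hn.mono fun v hv => (hu.hasDerivAt_potential_fst hv).hasFDerivAt)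
      (hn.mono fun v hv => (hu.hasDerivAt_potential_snd hν hv).hasFDerivAt)
      ((ContinuousLinearMap.toSpanSingletonCLE (𝕜 := ℝ) (E := ℝ)).continuous.continuousAt.comp hcu)
      ((ContinuousLinearMap.toSpanSingletonCLE (𝕜 := ℝ) (E := ℝ)).continuous.continuousAt.comp
        hcq)).hasFDerivAt
    refine this.congr_fderiv ?_
    ext <;> simp [Function.HasUncurry.uncurry]
  · rintro ⟨x, t⟩ ht
    have ht : 0 ≤ t := ht
    -- Joint continuity up to time zero: continuity in `t` at fixed `x`, plus a Lipschitz bound in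
    -- `x` uniform in `t`.
    have h1 : Tendsto (fun z : ℝ × ℝ => potential ν u₀ u x z.2)
        (𝓝[{z : ℝ × ℝ | 0 ≤ z.2}] (x, t)) (𝓝 (potential ν u₀ u x t)) := by
      refine (hsnd x t ht).tendsto.comp ?_
      exact tendsto_nhdsWithin_iff.2 ⟨(continuous_snd.tendsto (x, t)).mono_left
        nhdsWithin_le_nhds, self_mem_nhdsWithin⟩
    have h2 : Tendsto (fun z : ℝ × ℝ => potential ν u₀ u z.1 z.2 - potential ν u₀ u x z.2)
        (𝓝[{z : ℝ × ℝ | 0 ≤ z.2}] (x, t)) (𝓝 0) := by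
      have h3 : Tendsto (fun z : ℝ × ℝ => max M M₀ * |z.1 - x|)
          (𝓝[{z : ℝ × ℝ | 0 ≤ z.2}] (x, t)) (𝓝 0) := by
        have : Continuous (fun z : ℝ × ℝ => max M M₀ * |z.1 - x|) := by fun_prop
        simpa using (this.tendsto (x, t)).mono_left nhdsWithin_le_nhds
      exact squeeze_zero_norm (fun z => hu.abs_potential_sub_le hm hM hM₀ _ _) h3
    have := h1.add h2
    simpa [ContinuousWithinAt] using this
  · intro x
    simp [potential]
  · intro T
    obtain ⟨C, hC⟩ := (isCompact_Icc (a := (0 : ℝ)) (b := T)).exists_bound_of_continuousOn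
      ((hsnd 0).mono Icc_subset_Ici_self)
    refine ⟨|C| + |max M M₀|, fun x t h0 hT => ?_⟩
    have h1 := hC t ⟨h0, hT⟩
    have h2 := hu.abs_potential_sub_le (t := t) hm hM hM₀ x 0
    rw [Real.norm_eq_abs] at h1
    rw [sub_zero] at h2
    have h3 := abs_sub_abs_le_abs_sub (potential ν u₀ u x t) (potential ν u₀ u 0 t)
    have h4 := mul_le_mul_of_nonneg_right (le_abs_self (max M M₀)) (abs_nonneg x)
    nlinarith [le_abs_self C, abs_nonneg C, abs_nonneg x, abs_nonneg (max M M₀),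
      mul_nonneg (abs_nonneg C) (abs_nonneg x)]

end Construction

/-! ### Maximum principle and uniqueness for the heat equation -/

/-- A positive second derivative would make the maximum a local minimum too; the function would be
locally constant and its second derivative zero. -/
lemma second_deriv_nonpos_of_isLocalMax {f f' : ℝ → ℝ} {f'' x : ℝ}
    (hf : ∀ y, HasDerivAt f (f' y) y) (hf' : HasDerivAt f' f'' x) (hmax : IsLocalMax f x) :
    f'' ≤ 0 := by
  by_contra! hpos
  have hd : deriv f = f' := funext fun y => (hf y).deriv
  have hmin : IsLocalMin f x := isLocalMin_of_deriv_deriv_pos (by rw [hd, hf'.deriv]; exact hpos)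
    hmax.deriv_eq_zero (hf x).continuousAt
  have hc : f =ᶠ[𝓝 x] fun _ => f x := by
    filter_upwards [hmax, hmin] with y h1 h2 using le_antisymm h1 h2
  have := hc.deriv.deriv_eq
  rw [hd, hf'.deriv] at this
  simp at this
  linarith

/-- Only left difference quotients are used, because the maximum over a space-time box may lie at
its final time. -/
lemma deriv_nonneg_of_le_left {f : ℝ → ℝ} {f' t : ℝ} (ht : 0 < t) (hf : HasDerivAt f f' t)
    (hmax : ∀ s, 0 ≤ s → s ≤ t → f s ≤ f t) : 0 ≤ f' := by
  have h := (hasDerivWithinAt_iff_tendsto_slope' (s := Iio t) (by simp)).1 hf.hasDerivWithinAt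
  refine ge_of_tendsto h ?_
  filter_upwards [Ioo_mem_nhdsLT ht] with s hs
  rw [slope_def_field]
  exact div_nonneg_of_nonpos (by linarith [hmax s hs.1.le hs.2.le]) (by linarith [hs.2])

/-- `v` solves the heat equation with diffusivity `ν` for positive times, is continuous up to time
zero and grows at most exponentially in space; `vx` and `vxx` are its derivatives in space. -/
structure IsHeatSolution (ν : ℝ) (v vx vxx : ℝ → ℝ → ℝ) : Prop where
  hasDerivAt_fst : ∀ x t, 0 < t → HasDerivAt (fun y => v y t) (vx x t) x
  hasDerivAt_fst_fst : ∀ x t, 0 < t → HasDerivAt (fun y => vx y t) (vxx x t) x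
  hasDerivAt_snd : ∀ x t, 0 < t → HasDerivAt (fun τ => v x τ) (ν * vxx x t) t
  continuousOn : ContinuousOn (fun z : ℝ × ℝ => v z.1 z.2) {z : ℝ × ℝ | 0 ≤ z.2}
  growth : ∀ T, ∃ C B, 0 ≤ C ∧ 0 ≤ B ∧ ∀ x t, 0 ≤ t → t ≤ T → |v x t| ≤ C * Real.exp (B * |x|)

section Heat

variable {ν : ℝ} {v vx vxx w wx wxx : ℝ → ℝ → ℝ}

lemma IsHeatSolution.const_mul (hv : IsHeatSolution ν v vx vxx) (a : ℝ) :
    IsHeatSolution ν (fun x t => a * v x t) (fun x t => a * vx x t) (fun x t => a * vxx x t) := by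
  refine ⟨fun x t ht => (hv.hasDerivAt_fst x t ht).const_mul a,
    fun x t ht => (hv.hasDerivAt_fst_fst x t ht).const_mul a,
    fun x t ht => ((hv.hasDerivAt_snd x t ht).const_mul a).congr_deriv (by ring),
    continuousOn_const.mul hv.continuousOn, fun T => ?_⟩
  obtain ⟨C, B, hC, hB, h⟩ := hv.growth T
  refine ⟨|a| * C, B, by positivity, hB, fun x t h0 hT => ?_⟩
  rw [abs_mul, mul_assoc]
  exact mul_le_mul_of_nonneg_left (h x t h0 hT) (abs_nonneg a)

lemma IsHeatSolution.add (hv : IsHeatSolution ν v vx vxx) (hw : IsHeatSolution ν w wx wxx) :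
    IsHeatSolution ν (fun x t => v x t + w x t) (fun x t => vx x t + wx x t)
      (fun x t => vxx x t + wxx x t) := by
  refine ⟨fun x t ht => (hv.hasDerivAt_fst x t ht).add (hw.hasDerivAt_fst x t ht),
    fun x t ht => (hv.hasDerivAt_fst_fst x t ht).add (hw.hasDerivAt_fst_fst x t ht),
    fun x t ht => ((hv.hasDerivAt_snd x t ht).add (hw.hasDerivAt_snd x t ht)).congr_deriv (by ring),
    hv.continuousOn.add hw.continuousOn, fun T => ?_⟩
  obtain ⟨C, B, hC, hB, h⟩ := hv.growth T
  obtain ⟨C', B', hC', hB', h'⟩ := hw.growth T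
  refine ⟨C + C', max B B', by positivity, by positivity, fun x t h0 hT => ?_⟩
  have h1 : Real.exp (B * |x|) ≤ Real.exp (max B B' * |x|) := by
    gcongr; exact le_max_left _ _
  have h2 : Real.exp (B' * |x|) ≤ Real.exp (max B B' * |x|) := by
    gcongr; exact le_max_right _ _
  calc |v x t + w x t| ≤ |v x t| + |w x t| := abs_add_le _ _
    _ ≤ C * Real.exp (max B B' * |x|) + C' * Real.exp (max B B' * |x|) :=
      add_le_add ((h x t h0 hT).trans (mul_le_mul_of_nonneg_left h1 hC))
        ((h' x t h0 hT).trans (mul_le_mul_of_nonneg_left h2 hC'))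
    _ = _ := by ring

lemma exp_abs_le_two_mul_cosh (x : ℝ) : Real.exp |x| ≤ 2 * Real.cosh x := by
  rw [← Real.cosh_abs, Real.cosh_eq]
  linarith [Real.exp_pos (-|x|)]

/-- Maximum principle for exponentially growing solutions of the heat equation. -/
lemma IsHeatSolution.nonpos (hν : 0 < ν) (hv : IsHeatSolution ν v vx vxx)
    (h0 : ∀ x, v x 0 ≤ 0) (x t : ℝ) (ht : 0 ≤ t) : v x t ≤ 0 := by
  obtain ⟨C, B, hC, hB, hgr⟩ := hv.growth t
  -- The barrier `ε e^{κt} cosh(bx)` outgrows `v` because `b > B`, and it is a strict supersolution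
  -- because `κ > ν b²`.
  set b := B + 1 with hb
  set κ := ν * b ^ 2 + 1 with hκ
  have main : ∀ ε > 0, v x t ≤ ε * (Real.exp (κ * t) * Real.cosh (b * x)) := by
    intro ε hε
    set h : ℝ → ℝ → ℝ := fun y τ => ε * (Real.exp (κ * τ) * Real.cosh (b * y)) with hh
    have hhpos : ∀ y τ, 0 < h y τ := fun y τ => by
      have := Real.cosh_pos (b * y)
      positivity
    -- For `|y| ≥ R` one has `ε e^{|y|} ≥ 2C`, so the spare exponent in `b = B + 1` puts the barrier
    -- above `v` there. A positive maximum of `v - h` thus has `|x₁| < R` and `t₁ > 0`.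
    set R := max |x| (2 * C / ε) with hR
    have hRx : |x| ≤ R := le_max_left _ _
    have hR0 : 0 ≤ R := (abs_nonneg x).trans hRx
    have hside : ∀ y τ, 0 ≤ τ → τ ≤ t → R ≤ |y| → v y τ ≤ h y τ := by
      intro y τ hτ0 hτt hy
      have h1 := (le_abs_self _).trans (hgr y τ hτ0 hτt)
      have h2 : 2 * C ≤ ε * Real.exp |y| := by
        have h3 : 2 * C / ε ≤ |y| := (le_max_right _ _).trans hy
        rw [div_le_iff₀ hε] at h3
        nlinarith [Real.add_one_le_exp |y|]
      have h4 : Real.exp |y| * Real.exp (B * |y|) ≤ 2 * Real.cosh (b * y) := by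
        rw [← Real.exp_add]
        refine le_trans (le_of_eq ?_) (exp_abs_le_two_mul_cosh (b * y))
        rw [abs_mul, abs_of_nonneg (by positivity : 0 ≤ b), hb]
        congr 1; ring
      have h5 : 1 ≤ Real.exp (κ * τ) := Real.one_le_exp (by positivity)
      have h6 := Real.cosh_pos (b * y)
      have h7 : C * Real.exp (B * |y|) ≤ ε * Real.cosh (b * y) := by
        nlinarith [mul_le_mul_of_nonneg_right h2 (Real.exp_pos (B * |y|)).le,
          mul_le_mul_of_nonneg_left h4 hε.le]
      have h8 : ε * Real.cosh (b * y) ≤ h y τ := by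
        refine mul_le_mul_of_nonneg_left ?_ hε.le
        exact le_mul_of_one_le_left h6.le h5
      linarith
    set K : Set (ℝ × ℝ) := Icc (-R) R ×ˢ Icc 0 t with hK
    have hKc : IsCompact K := isCompact_Icc.prod isCompact_Icc
    have hxK : (x, t) ∈ K := ⟨abs_le.1 hRx, ht, le_rfl⟩
    have hzc : ContinuousOn (fun z : ℝ × ℝ => v z.1 z.2 - h z.1 z.2) K := by
      refine (hv.continuousOn.mono fun z hz => hz.2.1).sub ?_
      have : Continuous (fun z : ℝ × ℝ => h z.1 z.2) := by
        have := Real.continuous_cosh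
        simp only [hh]; fun_prop
      exact this.continuousOn
    obtain ⟨⟨x₁, t₁⟩, ⟨hx₁, ht₁⟩, hmax⟩ := hKc.exists_isMaxOn ⟨_, hxK⟩ hzc
    simp only at hx₁ ht₁
    suffices v x₁ t₁ - h x₁ t₁ ≤ 0 by
      have h1 : v x t - h x t ≤ v x₁ t₁ - h x₁ t₁ := hmax hxK
      linarith
    by_contra! hpos
    have ht₁0 : 0 < t₁ := by
      rcases eq_or_lt_of_le ht₁.1 with rfl | h1
      · linarith [h0 x₁, hhpos x₁ 0]
      · exact h1
    have hx₁R : |x₁| < R := by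
      by_contra! h1
      linarith [hside x₁ t₁ ht₁.1 ht₁.2 h1]
    have dx : ∀ y, HasDerivAt (fun y => v y t₁ - h y t₁)
        (vx y t₁ - ε * (Real.exp (κ * t₁) * (b * Real.sinh (b * y)))) y := fun y => by
      refine (hv.hasDerivAt_fst y t₁ ht₁0).sub
        (((HasDerivAt.cosh ((hasDerivAt_id y).const_mul b)).const_mul _).const_mul _ |>.congr_deriv ?_)
      simp only [id, mul_one]; ring
    have dxx : HasDerivAt (fun y => vx y t₁ - ε * (Real.exp (κ * t₁) * (b * Real.sinh (b * y))))
        (vxx x₁ t₁ - b ^ 2 * h x₁ t₁) x₁ := by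
      refine (hv.hasDerivAt_fst_fst x₁ t₁ ht₁0).sub
        ((((HasDerivAt.sinh ((hasDerivAt_id x₁).const_mul b)).const_mul _).const_mul _).const_mul _
          |>.congr_deriv ?_)
      simp [hh]; ring
    have dt : HasDerivAt (fun τ => v x₁ τ - h x₁ τ) (ν * vxx x₁ t₁ - κ * h x₁ t₁) t₁ := by
      refine (hv.hasDerivAt_snd x₁ t₁ ht₁0).sub
        (((HasDerivAt.exp ((hasDerivAt_id t₁).const_mul κ)).mul_const _).const_mul _
          |>.congr_deriv ?_)
      simp [hh]; ring
    have e1 : vxx x₁ t₁ - b ^ 2 * h x₁ t₁ ≤ 0 := by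
      refine second_deriv_nonpos_of_isLocalMax dx dxx ?_
      filter_upwards [Icc_mem_nhds (abs_lt.1 hx₁R).1 (abs_lt.1 hx₁R).2] with y hy
      exact hmax (show (y, t₁) ∈ K from ⟨hy, ht₁⟩)
    have e2 : 0 ≤ ν * vxx x₁ t₁ - κ * h x₁ t₁ :=
      deriv_nonneg_of_le_left ht₁0 dt fun s hs0 hs =>
        hmax (show (x₁, s) ∈ K from ⟨hx₁, hs0, hs.trans ht₁.2⟩)
    -- Together these give `0 ≤ ν v_xx - κh ≤ (ν b² - κ) h = -h`, contradicting `h > 0`.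
    have e3 := mul_le_mul_of_nonneg_left e1 hν.le
    rw [hκ] at e2
    nlinarith [hhpos x₁ t₁]
  have hlim : Tendsto (fun ε : ℝ => ε * (Real.exp (κ * t) * Real.cosh (b * x))) (𝓝[>] 0) (𝓝 0) := by
    have : Continuous (fun ε : ℝ => ε * (Real.exp (κ * t) * Real.cosh (b * x))) := by fun_prop
    simpa using (this.tendsto 0).mono_left nhdsWithin_le_nhds
  refine ge_of_tendsto hlim ?_
  filter_upwards [self_mem_nhdsWithin] with ε hε using main ε hε

/-- Uniqueness for the heat equation in the class of exponentially growing functions. -/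
theorem IsHeatSolution.eq_of_initial_eq (hν : 0 < ν) (hv : IsHeatSolution ν v vx vxx)
    (hw : IsHeatSolution ν w wx wxx) (h0 : ∀ x, v x 0 = w x 0) (x t : ℝ) (ht : 0 ≤ t) :
    v x t = w x t := by
  have h1 := (hv.add (hw.const_mul (-1))).nonpos hν (fun y => by simp [h0 y]) x t ht
  have h2 := (hw.add (hv.const_mul (-1))).nonpos hν (fun y => by simp [h0 y]) x t ht
  linarith

end Heat

/-! ### Cole-Hopf transform, uniqueness and symmetries of potentials -/

section Potential

variable {ν : ℝ} {u u' : ℝ → ℝ → ℝ} {U₀ U₀' : ℝ → ℝ} {U U' : ℝ → ℝ → ℝ}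

lemma IsPotential.hasDerivAt_fst (hU : IsPotential ν u U₀ U) {x t : ℝ} (ht : 0 < t) :
    HasDerivAt (fun y => U y t) (u x t) x := by
  have h := (hU.hasFDerivAt x t ht).comp_hasDerivAt x
    ((hasDerivAt_id x).prodMk (hasDerivAt_const x t))
  simpa [Function.comp_def] using h

lemma IsPotential.hasDerivAt_snd (hU : IsPotential ν u U₀ U) {x t : ℝ} (ht : 0 < t) :
    HasDerivAt (fun τ => U x τ) (burgersRate ν u x t) t := by
  have h := (hU.hasFDerivAt x t ht).comp_hasDerivAt t
    ((hasDerivAt_const t x).prodMk (hasDerivAt_id t))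
  simpa [Function.comp_def] using h

/-- The Cole-Hopf transform of a potential. -/
noncomputable def coleHopf (ν : ℝ) (U : ℝ → ℝ → ℝ) (x t : ℝ) : ℝ := Real.exp (-U x t / (2 * ν))

lemma coleHopf_pos (ν : ℝ) (U : ℝ → ℝ → ℝ) (x t : ℝ) : 0 < coleHopf ν U x t := Real.exp_pos _

lemma IsPotential.hasDerivAt_coleHopf (hU : IsPotential ν u U₀ U) {x t : ℝ} (ht : 0 < t) :
    HasDerivAt (fun y => coleHopf ν U y t) (-u x t / (2 * ν) * coleHopf ν U x t) x :=
  (((hU.hasDerivAt_fst ht).neg.div_const (2 * ν)).exp).congr_deriv (by simp [coleHopf]; ring)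

/-- The potential satisfies `U_t + U_x²/2 = ν U_xx`, and the exponential removes the quadratic term.
Linear growth of `U` becomes exponential growth, the class in which uniqueness is available. -/
lemma IsPotential.isHeatSolution (hν : 0 < ν) (hU : IsPotential ν u U₀ U) :
    IsHeatSolution ν (coleHopf ν U) (fun x t => -u x t / (2 * ν) * coleHopf ν U x t)
      (fun x t => (-deriv (fun y => u y t) x / (2 * ν) + (u x t / (2 * ν)) ^ 2)
        * coleHopf ν U x t) := by
  refine ⟨fun x t ht => hU.hasDerivAt_coleHopf ht, fun x t ht => ?_, fun x t ht => ?_, ?_,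
    fun T => ?_⟩
  · refine (((hU.differentiable x t ht).hasDerivAt.neg.div_const (2 * ν)).mul
      (hU.hasDerivAt_coleHopf ht)).congr_deriv ?_
    simp only [Pi.neg_apply]
    ring
  · refine (((hU.hasDerivAt_snd ht).neg.div_const (2 * ν)).exp).congr_deriv ?_
    simp only [burgersRate, coleHopf, Pi.neg_apply]
    field_simp
    ring
  · exact (hU.continuousOn.neg.div_const _).rexp
  · obtain ⟨C, hC⟩ := hU.growth T
    refine ⟨Real.exp (|C| / (2 * ν)), |C| / (2 * ν), by positivity, by positivity,
      fun x t h0 hT => ?_⟩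
    rw [abs_of_pos (coleHopf_pos _ _ _ _), coleHopf, ← Real.exp_add, Real.exp_le_exp,
      div_mul_eq_mul_div, ← add_div]
    have h1 := hC x t h0 hT
    have h2 := mul_le_mul_of_nonneg_right (le_abs_self C) (by positivity : 0 ≤ 1 + |x|)
    gcongr
    linarith [neg_abs_le (U x t)]

/-- A potential is determined by its initial values. -/
theorem IsPotential.unique (hν : 0 < ν) (hU : IsPotential ν u U₀ U) (hU' : IsPotential ν u' U₀ U')
    (x t : ℝ) (ht : 0 ≤ t) : U x t = U' x t := by
  have h := (hU.isHeatSolution hν).eq_of_initial_eq hν (hU'.isHeatSolution hν)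
    (fun y => by simp [coleHopf, hU.initial, hU'.initial]) x t ht
  have h2 := Real.exp_injective h
  field_simp at h2
  linarith

/-- Galilean invariance of Burgers' equation at the level of potentials. -/
lemma IsPotential.galilean (hU : IsPotential ν u U₀ U) (c : ℝ) :
    IsPotential ν (fun x t => u (x - c * t) t + c) (fun x => U₀ x + c * x)
      (fun x t => U (x - c * t) t + c * x - c ^ 2 / 2 * t) := by
  refine ⟨fun x t ht => ?_, fun x t ht => ?_, ?_, fun x => ?_, fun T => ?_⟩
  · have h : DifferentiableAt ℝ (fun y => u (y - c * t) t) x :=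
      DifferentiableAt.comp x (g := fun y => u y t) (f := fun y => y - c * t)
        (hU.differentiable (x - c * t) t ht) (by fun_prop)
    exact h.add_const c
  · have h1 : HasFDerivAt (fun z : ℝ × ℝ => (z.1 - c * z.2, z.2))
        ((ContinuousLinearMap.fst ℝ ℝ ℝ - c • ContinuousLinearMap.snd ℝ ℝ ℝ).prod
          (ContinuousLinearMap.snd ℝ ℝ ℝ)) (x, t) :=
      (hasFDerivAt_fst.sub (hasFDerivAt_snd.const_mul c)).prodMk hasFDerivAt_snd
    have h2 := (hU.hasFDerivAt (x - c * t) t ht).comp (x, t) h1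
    have h3 := (h2.add (hasFDerivAt_fst.const_mul c)).sub (hasFDerivAt_snd.const_mul (c ^ 2 / 2))
    have hd : deriv (fun y => u (y - c * t) t + c) x = deriv (fun y => u y t) (x - c * t) := by
      rw [deriv_add_const]
      exact deriv_comp_sub_const (f := fun y => u y t) (c * t) x
    refine h3.congr_fderiv ?_
    ext
    · simp
    · simp [burgersRate, hd]; ring
  · have h1 : ContinuousOn (fun z : ℝ × ℝ => U (z.1 - c * z.2) z.2) {z : ℝ × ℝ | 0 ≤ z.2} :=
      hU.continuousOn.comp (f := fun z : ℝ × ℝ => (z.1 - c * z.2, z.2)) (by fun_prop)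
        (fun z hz => hz)
    exact (h1.add (by fun_prop)).sub (by fun_prop)
  · simp [hU.initial]
  · obtain ⟨C, hC⟩ := hU.growth T
    refine ⟨|C| * (1 + |c| * |T|) + |c| + c ^ 2 / 2 * |T|, fun x t h0 hT => ?_⟩
    have hTT : t ≤ |T| := hT.trans (le_abs_self T)
    have h1 : |U (x - c * t) t| ≤ |C| * (1 + (|x| + |c| * |T|)) := by
      refine (hC _ t h0 hT).trans ?_
      refine mul_le_mul (le_abs_self C) ?_ (by positivity) (abs_nonneg C)
      have := abs_sub x (c * t)
      rw [abs_mul, abs_of_nonneg h0] at this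
      nlinarith [mul_le_mul_of_nonneg_left hTT (abs_nonneg c)]
    have h2 : |c ^ 2 / 2 * t| ≤ c ^ 2 / 2 * |T| := by
      rw [abs_of_nonneg (by positivity)]
      exact mul_le_mul_of_nonneg_left hTT (by positivity)
    have h3 := abs_sub (U (x - c * t) t + c * x) (c ^ 2 / 2 * t)
    have h4 := abs_add_le (U (x - c * t) t) (c * x)
    rw [abs_mul] at h4
    have h5 : 0 ≤ |C| * (|c| * |T|) * |x| := by positivity
    have h6 : 0 ≤ c ^ 2 / 2 * |T| * |x| := by positivity
    nlinarith [abs_nonneg c, abs_nonneg C, abs_nonneg x]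

/-- Translation invariance of Burgers' equation at the level of potentials. -/
lemma IsPotential.translate (hU : IsPotential ν u U₀ U) (p d : ℝ) :
    IsPotential ν (fun x t => u (x - p) t) (fun x => U₀ (x - p) + d)
      (fun x t => U (x - p) t + d) := by
  refine ⟨fun x t ht => ?_, fun x t ht => ?_, ?_, fun x => ?_, fun T => ?_⟩
  · exact DifferentiableAt.comp x (g := fun y => u y t) (f := fun y => y - p)
      (hU.differentiable (x - p) t ht) (by fun_prop)
  · have h1 : HasFDerivAt (fun z : ℝ × ℝ => (z.1 - p, z.2))
        ((ContinuousLinearMap.fst ℝ ℝ ℝ).prod (ContinuousLinearMap.snd ℝ ℝ ℝ)) (x, t) :=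
      (hasFDerivAt_fst.sub_const p).prodMk hasFDerivAt_snd
    have h2 := ((hU.hasFDerivAt (x - p) t ht).comp (x, t) h1).add_const d
    have hd : deriv (fun y => u (y - p) t) x = deriv (fun y => u y t) (x - p) :=
      deriv_comp_sub_const (f := fun y => u y t) p x
    refine h2.congr_fderiv ?_
    ext
    · simp
    · simp [burgersRate, hd]
  · have h1 : ContinuousOn (fun z : ℝ × ℝ => U (z.1 - p) z.2) {z : ℝ × ℝ | 0 ≤ z.2} :=
      hU.continuousOn.comp (f := fun z : ℝ × ℝ => (z.1 - p, z.2)) (by fun_prop)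
        (fun z hz => hz)
    exact h1.add (by fun_prop)
  · simp [hU.initial]
  · obtain ⟨C, hC⟩ := hU.growth T
    refine ⟨|C| * (1 + |p|) + |d|, fun x t h0 hT => ?_⟩
    have h1 : |U (x - p) t| ≤ |C| * (1 + (|x| + |p|)) := by
      refine (hC _ t h0 hT).trans ?_
      refine mul_le_mul (le_abs_self C) ?_ (by positivity) (abs_nonneg C)
      linarith [abs_sub x p]
    have h4 := abs_add_le (U (x - p) t) d
    have h5 : 0 ≤ |C| * |p| * |x| := by positivity
    nlinarith [abs_nonneg d, abs_nonneg C, abs_nonneg x]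

end Potential

/-! ### Explicit form of the shock profile -/

section Profile

variable {ul ur : ℝ} {φ : ℝ → ℝ}

/-- By the mean value theorem on `[x, x + 1]`, the derivative takes values tending to zero along
points that escape to infinity. -/
lemma eq_zero_of_tendsto_of_deriv_tendsto {f f' : ℝ → ℝ} {A L : ℝ}
    (hf : ∀ x, HasDerivAt f (f' x) x) (hA : Tendsto f atTop (𝓝 A))
    (hL : Tendsto f' atTop (𝓝 L)) : L = 0 := by
  have hmvt : ∀ x : ℝ, ∃ y ∈ Ioo x (x + 1), f' y = (f (x + 1) - f x) / (x + 1 - x) := fun x =>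
    exists_hasDerivAt_eq_slope f f' (by linarith)
      (fun y _ => (hf y).continuousAt.continuousWithinAt) (fun y _ => hf y)
  choose y hy hy' using hmvt
  have hy_top : Tendsto y atTop atTop := tendsto_atTop_mono (fun x => (hy x).1.le) tendsto_id
  have h1 := hL.comp hy_top
  have h2 : Tendsto (fun x => f (x + 1) - f x) atTop (𝓝 (A - A)) :=
    (hA.comp (tendsto_atTop_add_const_right _ 1 tendsto_id)).sub hA
  rw [sub_self] at h2
  refine tendsto_nhds_unique h1 (h2.congr fun x => ?_)
  rw [Function.comp_apply, hy']
  ring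

lemma shockSpeed_burgersFlux (h : ur < ul) : shockSpeed burgersFlux ul ur = (ul + ur) / 2 := by
  have : ul - ur ≠ 0 := by linarith
  unfold shockSpeed burgersFlux
  field_simp
  ring

lemma hasDerivAt_burgersFlux (v : ℝ) : HasDerivAt burgersFlux v v := by
  have := ((hasDerivAt_id v).pow 2).div_const 2
  refine HasDerivAt.congr_deriv (f := burgersFlux) this ?_
  simp

/-- The once integrated profile equation. -/
lemma IsShockProfile.hasDerivAt (h : ur < ul) (hφ : IsShockProfile burgersFlux 1 ul ur φ) (x : ℝ) :
    HasDerivAt φ ((φ x - ul) * (φ x - ur) / 2) x := by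
  have hd : ∀ x, HasDerivAt φ (deriv φ x) x := fun x =>
    (hφ.contDiff.differentiable (by norm_num) x).hasDerivAt
  have hdd : ∀ x, HasDerivAt (deriv φ) (iteratedDeriv 2 φ x) x := fun x => by
    have h1 : ContDiff ℝ 1 (deriv φ) := (contDiff_succ_iff_deriv.1
      (show ContDiff ℝ (1 + 1) φ by simpa [one_add_one_eq_two] using hφ.contDiff)).2.2
    have := (h1.differentiable (by norm_num) x).hasDerivAt
    rwa [iteratedDeriv_succ, iteratedDeriv_one]
  have hc : ∀ x, HasDerivAt (fun x => deriv φ x - φ x ^ 2 / 2 + (ul + ur) / 2 * φ x) 0 x := by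
    intro x
    have he := hφ.equation x
    rw [one_mul, shockSpeed_burgersFlux h, (hasDerivAt_burgersFlux _).deriv] at he
    refine (((hdd x).sub (((hd x).pow 2).div_const 2)).add ((hd x).const_mul _)).congr_deriv ?_
    rw [he]; push_cast; ring
  have hconst : ∀ x, deriv φ x = φ x ^ 2 / 2 - (ul + ur) / 2 * φ x
      + (deriv φ 0 - φ 0 ^ 2 / 2 + (ul + ur) / 2 * φ 0) := by
    intro x
    have := is_const_of_deriv_eq_zero (fun x => (hc x).differentiableAt) (fun x => (hc x).deriv) x 0
    linarith
  set C := deriv φ 0 - φ 0 ^ 2 / 2 + (ul + ur) / 2 * φ 0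
  have hlim : Tendsto (deriv φ) atTop (𝓝 (ur ^ 2 / 2 - (ul + ur) / 2 * ur + C)) := by
    have hr := hφ.limit_right
    rw [funext hconst]
    exact (((hr.pow 2).div_const 2).sub (hr.const_mul _)).add_const _
  -- The derivative has a limit at `+∞`, necessarily zero; this fixes the constant of integration
  -- and factors the quadratic.
  have h0 := eq_zero_of_tendsto_of_deriv_tendsto hd hφ.limit_right hlim
  refine (hd x).congr_deriv ?_
  rw [hconst x]
  linarith

/-- Once one root `r` is split off, the Riccati equation is linear in `φ - r`, with coefficient `(φ
- r')/2`; the integrating factor is explicit. -/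
lemma riccati_mul_exp {r r' : ℝ} {φ : ℝ → ℝ}
    (hφ : ∀ x, HasDerivAt φ ((φ x - r) * (φ x - r') / 2) x) (x : ℝ) :
    (φ x - r) * Real.exp (-(∫ z in (0 : ℝ)..x, φ z) / 2)
      = (φ 0 - r) * Real.exp (-(r' * x) / 2) := by
  have hcont : Continuous φ := continuous_iff_continuousAt.2 fun x => (hφ x).continuousAt
  have hI : ∀ x, HasDerivAt (fun x => ∫ z in (0 : ℝ)..x, φ z) (φ x) x := fun x =>
    intervalIntegral.integral_hasDerivAt_right (hcont.intervalIntegrable _ _)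
      (hcont.stronglyMeasurableAtFilter _ _) hcont.continuousAt
  have hd : ∀ x, HasDerivAt (fun x => (φ x - r) * Real.exp (-(∫ z in (0 : ℝ)..x, φ z) / 2)
      * Real.exp (r' * x / 2)) 0 x := fun x => by
    refine ((((hφ x).sub_const r).mul ((hI x).neg.div_const 2).exp).mul
      (((hasDerivAt_id x).const_mul r').div_const 2).exp).congr_deriv ?_
    simp only [id, Pi.neg_apply, Pi.mul_apply]
    ring
  have := is_const_of_deriv_eq_zero (fun x => (hd x).differentiableAt) (fun x => (hd x).deriv) x 0
  simp only [intervalIntegral.integral_same, mul_zero, neg_zero, zero_div, Real.exp_zero,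
    mul_one] at this
  rw [← this, mul_assoc _ (Real.exp (r' * x / 2)), ← Real.exp_add]
  rw [show r' * x / 2 + -(r' * x) / 2 = 0 by ring, Real.exp_zero, mul_one]

/-- The logistic function with parameters `a`, `b`. -/
noncomputable def logistic (a b y : ℝ) : ℝ := a / (a + b * Real.exp y)

/-- Explicit form of the shock profiles of Burgers' equation. -/
theorem IsShockProfile.exists_explicit {ν : ℝ} (hν : 0 < ν) (h : ur < ul)
    (hφ : IsShockProfile burgersFlux 1 ul ur φ) :
    ∃ a b : ℝ, 0 < a ∧ 0 < b ∧
      (∀ x, Real.exp (-(∫ z in (0 : ℝ)..x, scaledProfile φ ν z) / (2 * ν))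
        = a * Real.exp (-(ul * x) / (2 * ν)) + b * Real.exp (-(ur * x) / (2 * ν))) ∧
      ∀ x, weight φ ν ul ur x = logistic a b ((ul - ur) / (2 * ν) * x) := by
  have hc : 0 < ul - ur := by linarith
  have hd := hφ.hasDerivAt h
  have e1 := riccati_mul_exp (r := ul) (r' := ur) hd
  have e2 := riccati_mul_exp (r := ur) (r' := ul) (fun x => (hd x).congr_deriv (by ring))
  -- By the integrated identity, `φ - ur` has the same sign everywhere, and it is positive near
  -- `-∞`; likewise `ul - φ` near `+∞`.
  have ha : 0 < φ 0 - ur := by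
    obtain ⟨x, hx⟩ := (hφ.limit_left.eventually (lt_mem_nhds h)).exists
    have := e2 x
    have h3 : 0 < (φ x - ur) * Real.exp (-(∫ z in (0 : ℝ)..x, φ z) / 2) :=
      mul_pos (by linarith) (Real.exp_pos _)
    rw [this] at h3
    exact (pos_iff_pos_of_mul_pos h3).2 (Real.exp_pos _)
  have hb : 0 < ul - φ 0 := by
    obtain ⟨x, hx⟩ := (hφ.limit_right.eventually (gt_mem_nhds h)).exists
    have := e1 x
    have h3 : 0 < (ul - φ x) * Real.exp (-(∫ z in (0 : ℝ)..x, φ z) / 2) :=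
      mul_pos (by linarith) (Real.exp_pos _)
    have h4 : 0 < (ul - φ 0) * Real.exp (-(ur * x) / 2) := by linarith
    exact (pos_iff_pos_of_mul_pos h4).2 (Real.exp_pos _)
  have hsc : ∀ x, -(∫ z in (0 : ℝ)..x, scaledProfile φ ν z) / (2 * ν)
      = -(∫ z in (0 : ℝ)..(x / ν), φ z) / 2 := fun x => by
    unfold scaledProfile
    rw [intervalIntegral.integral_comp_div _ hν.ne', zero_div, smul_eq_mul]
    field_simp
  have hE : ∀ r x : ℝ, -(r * (x / ν)) / 2 = -(r * x) / (2 * ν) := fun r x => by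
    field_simp
  -- Subtracting the identities for the two roots eliminates `φ` and leaves `ul - ur` times the
  -- exponential.
  have hexp : ∀ x, Real.exp (-(∫ z in (0 : ℝ)..x, scaledProfile φ ν z) / (2 * ν))
        = (φ 0 - ur) / (ul - ur) * Real.exp (-(ul * x) / (2 * ν))
          + (ul - φ 0) / (ul - ur) * Real.exp (-(ur * x) / (2 * ν)) := fun x => by
    have f1 := e1 (x / ν)
    have f2 := e2 (x / ν)
    rw [← hsc, hE] at f1 f2
    rw [div_mul_eq_mul_div, div_mul_eq_mul_div, ← add_div, eq_div_iff hc.ne']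
    linarith
  refine ⟨(φ 0 - ur) / (ul - ur), (ul - φ 0) / (ul - ur), by positivity, by positivity, hexp,
    fun x => ?_⟩
  have f2 := e2 (x / ν)
  rw [← hsc, hE, hexp] at f2
  have hxe : Real.exp (-(ur * x) / (2 * ν))
      = Real.exp ((ul - ur) / (2 * ν) * x) * Real.exp (-(ul * x) / (2 * ν)) := by
    rw [← Real.exp_add]; congr 1; field_simp; ring
  rw [hxe] at f2
  have hp := Real.exp_pos (-(ul * x) / (2 * ν))
  have hp2 := Real.exp_pos ((ul - ur) / (2 * ν) * x)
  unfold weight logistic scaledProfile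
  rw [div_eq_div_iff hc.ne' (by positivity)]
  have f3 : (φ (x / ν) - ur) * ((φ 0 - ur) / (ul - ur)
      + (ul - φ 0) / (ul - ur) * Real.exp ((ul - ur) / (2 * ν) * x)) = φ 0 - ur := by
    refine mul_right_cancel₀ hp.ne' ?_
    rw [← f2]; ring
  rw [f3]
  field_simp

end Profile

/-! ### Elementary properties of the logistic function -/

section Logistic

variable {a b : ℝ} (ha : 0 < a) (hb : 0 < b)
include ha hb

lemma logistic_pos (y : ℝ) : 0 < logistic a b y := by
  have := Real.exp_pos y
  unfold logistic; positivity

lemma one_sub_logistic (y : ℝ) : 1 - logistic a b y = b * Real.exp y / (a + b * Real.exp y) := by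
  have := Real.exp_pos y
  have : 0 < a + b * Real.exp y := by positivity
  unfold logistic; field_simp; ring

lemma logistic_lt_one (y : ℝ) : logistic a b y < 1 := by
  have := Real.exp_pos y
  have h : 0 < 1 - logistic a b y := by rw [one_sub_logistic ha hb]; positivity
  linarith

lemma hasDerivAt_logistic (y : ℝ) :
    HasDerivAt (logistic a b) (-(logistic a b y * (1 - logistic a b y))) y := by
  have := Real.exp_pos y
  have h0 : a + b * Real.exp y ≠ 0 := by positivity
  refine HasDerivAt.congr_deriv ((hasDerivAt_const y a).div
    (((Real.hasDerivAt_exp y).const_mul b).const_add a) h0) ?_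
  rw [one_sub_logistic ha hb, logistic]
  field_simp; ring

lemma logistic_le (y : ℝ) : logistic a b y ≤ a / b * Real.exp (-y) := by
  have := Real.exp_pos y
  rw [logistic, Real.exp_neg, ← div_eq_mul_inv, div_div]
  gcongr
  linarith

lemma one_sub_logistic_le (y : ℝ) : 1 - logistic a b y ≤ b / a * Real.exp y := by
  have := Real.exp_pos y
  rw [one_sub_logistic ha hb, div_mul_eq_mul_div]
  gcongr
  have : 0 < b * Real.exp y := by positivity
  linarith

end Logistic

/-! ### Superposition, and the solution at resonant times -/

/-- The Cole-Hopf description of the solution `u` that issues from a shock profile with a periodic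
perturbation, in terms of potentials `U`, `UL`, `UR` of `u` and of the two periodic solutions. -/
structure IsShockTriple (ν ul ur p a b : ℝ) (u uL uR U UL UR : ℝ → ℝ → ℝ) : Prop where
  potential : IsPotential ν u (fun x => U x 0) U
  potential_left : IsPotential ν uL (fun x => UL x 0) UL
  potential_right : IsPotential ν uR (fun x => UR x 0) UR
  superposition : ∀ x t, 0 ≤ t →
    coleHopf ν U x t = a * coleHopf ν UL x t + b * coleHopf ν UR x t
  galilean : ∀ x t, 0 ≤ t →
    UL x t = UR (x - (ul - ur) * t) t + (ul - ur) * x - (ul - ur) ^ 2 / 2 * t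
  periodic_left : ∀ x t, 0 ≤ t → UL x t = UL (x - p) t + ul * p
  periodic_right : ∀ x t, 0 ≤ t → UR x t = UR (x - p) t + ur * p

lemma IsPotential.of_initial {ν : ℝ} {u : ℝ → ℝ → ℝ} {U₀ : ℝ → ℝ} {U : ℝ → ℝ → ℝ}
    (hU : IsPotential ν u U₀ U) : IsPotential ν u (fun x => U x 0) U :=
  ⟨hU.differentiable, hU.hasFDerivAt, hU.continuousOn, fun _ => rfl, hU.growth⟩

lemma exists_ae_bound_of_memLp_top {w : ℝ → ℝ} (hw : MemLp w ⊤ volume) :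
    ∃ M, ∀ᵐ x, |w x| ≤ M := by
  have h := hw.2
  rw [eLpNorm_exponent_top] at h
  refine ⟨(eLpNormEssSup w volume).toReal, ?_⟩
  filter_upwards [ae_le_eLpNormEssSup (f := w) (μ := volume)] with x hx
  have := ENNReal.toReal_mono h.ne hx
  simpa using this

theorem exists_isShockTriple {ν ul ur p : ℝ} (hν : 0 < ν) (hu : ur < ul)
    {φ : ℝ → ℝ} (hφ : IsShockProfile burgersFlux 1 ul ur φ)
    {w₀ : ℝ → ℝ} (hw : MemLp w₀ ⊤ volume) (hper : Function.Periodic w₀ p)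
    (havg : ∫ x in (0 : ℝ)..p, w₀ x = 0)
    {u uL uR : ℝ → ℝ → ℝ}
    (hsol : IsBoundedSolution burgersFlux ν (fun x => scaledProfile φ ν x + w₀ x) u)
    (hL : IsBoundedSolution burgersFlux ν (fun x => ul + w₀ x) uL)
    (hR : IsBoundedSolution burgersFlux ν (fun x => ur + w₀ x) uR) :
    ∃ a b : ℝ, 0 < a ∧ 0 < b ∧
      (∀ x, weight φ ν ul ur x = logistic a b ((ul - ur) / (2 * ν) * x)) ∧
      ∃ U UL UR, IsShockTriple ν ul ur p a b u uL uR U UL UR := by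
  obtain ⟨a, b, ha, hb, hexp, hg⟩ := hφ.exists_explicit hν hu
  refine ⟨a, b, ha, hb, hg, ?_⟩
  have hc : 0 < ul - ur := by linarith
  obtain ⟨M, hM⟩ := exists_ae_bound_of_memLp_top hw
  have hwm := hw.1
  have hi : ∀ x y, IntervalIntegrable w₀ volume x y := fun x y =>
    (intervalIntegrable_const (c := M)).mono_fun hwm.restrict
      ((ae_restrict_of_ae hM).mono fun z hz => hz.trans (le_abs_self M))
  have hφc : Continuous (scaledProfile φ ν) := hφ.contDiff.continuous.comp (by fun_prop)
  have hφb : ∀ x, |scaledProfile φ ν x| ≤ |ul| + |ur| := fun x => by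
    have h1 := hg x
    rw [weight, div_eq_iff hc.ne'] at h1
    have h2 := logistic_pos ha hb ((ul - ur) / (2 * ν) * x)
    have h3 := logistic_lt_one ha hb ((ul - ur) / (2 * ν) * x)
    have h4 : 0 < scaledProfile φ ν x - ur := by rw [h1]; positivity
    have h5 : scaledProfile φ ν x - ur < ul - ur := by rw [h1]; nlinarith
    rw [abs_le]
    constructor
    · linarith [neg_abs_le ur, abs_nonneg ul]
    · linarith [le_abs_self ul, abs_nonneg ur]
  have hconst : ∀ r : ℝ, (fun x => ∫ z in (0 : ℝ)..x, (r + w₀ z))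
      = fun x => r * x + ∫ z in (0 : ℝ)..x, w₀ z := fun r => by
    ext x
    rw [intervalIntegral.integral_add intervalIntegrable_const (hi _ _)]
    simp [mul_comm]
  have hPL := hL.isPotential hν (hwm.const_add ul) (M₀ := |ul| + M)
    (hM.mono fun x hx => (abs_add_le _ _).trans (by linarith))
  have hPR := hR.isPotential hν (hwm.const_add ur) (M₀ := |ur| + M)
    (hM.mono fun x hx => (abs_add_le _ _).trans (by linarith))
  have hP := hsol.isPotential hν (hφc.aestronglyMeasurable.add hwm) (M₀ := |ul| + |ur| + M)
    (hM.mono fun x hx => (abs_add_le _ _).trans (by linarith [hφb x]))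
  rw [hconst] at hPL hPR
  set U := potential ν (fun x => scaledProfile φ ν x + w₀ x) u
  set UL := potential ν (fun x => ul + w₀ x) uL
  set UR := potential ν (fun x => ur + w₀ x) uR
  -- Zero mean over a period makes the primitive of `w₀` periodic.
  have hWper : ∀ x, ∫ z in (0 : ℝ)..(x - p), w₀ z = ∫ z in (0 : ℝ)..x, w₀ z := fun x => by
    have h1 := hper.intervalIntegral_add_eq (x - p) 0
    rw [sub_add_cancel, zero_add, havg] at h1
    have := intervalIntegral.integral_add_adjacent_intervals (hi 0 (x - p)) (hi (x - p) x)
    linarith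
  have htrans : ∀ {r : ℝ} {v V : ℝ → ℝ → ℝ},
      IsPotential ν v (fun x => r * x + ∫ z in (0 : ℝ)..x, w₀ z) V →
      ∀ x t, 0 ≤ t → V x t = V (x - p) t + r * p := by
    intro r v V hV
    have h1 := hV.translate p (r * p)
    have h2 : (fun x => r * (x - p) + (∫ z in (0 : ℝ)..(x - p), w₀ z) + r * p)
        = fun x => r * x + ∫ z in (0 : ℝ)..x, w₀ z := by
      ext x; rw [hWper]; ring
    rw [h2] at h1
    exact hV.unique hν h1
  refine ⟨U, UL, UR, hP.of_initial, hPL.of_initial, hPR.of_initial, ?_, ?_, htrans hPL,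
    htrans hPR⟩
  -- Superposition at time zero is `hexp` multiplied by `exp(-∫w₀/(2ν))`, the factor common to all
  -- three transforms.
  · refine (hP.isHeatSolution hν).eq_of_initial_eq hν (((hPL.isHeatSolution hν).const_mul a).add
      ((hPR.isHeatSolution hν).const_mul b)) fun x => ?_
    have e : ∀ r W : ℝ, -(r * x + W) / (2 * ν) = -(r * x) / (2 * ν) + -W / (2 * ν) :=
      fun r W => by ring
    have e' : ∀ V W : ℝ, -(V + W) / (2 * ν) = -V / (2 * ν) + -W / (2 * ν) :=
      fun V W => by ring
    simp only [coleHopf, hP.initial, hPL.initial, hPR.initial]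
    rw [intervalIntegral.integral_add (hφc.intervalIntegrable _ _) (hi _ _), e, e, e',
      Real.exp_add, Real.exp_add, Real.exp_add, hexp]
    ring
  -- The boost by `ul - ur` adds `(ul - ur) x` to the initial potential of `uR`, producing that of
  -- `uL`; uniqueness of potentials does the rest.
  · have h1 := hPR.galilean (ul - ur)
    have h2 : (fun x => ur * x + (∫ z in (0 : ℝ)..x, w₀ z) + (ul - ur) * x)
        = fun x => ul * x + ∫ z in (0 : ℝ)..x, w₀ z := by
      ext x; ring
    rw [h2] at h1
    exact hPL.unique hν h1

section Triple

variable {ν ul ur p a b : ℝ} {u uL uR U UL UR : ℝ → ℝ → ℝ}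

/-- `u` interpolates between the two periodic solutions. -/
lemma IsShockTriple.eq_logistic (hν : 0 < ν) (ha : 0 < a) (hb : 0 < b)
    (h : IsShockTriple ν ul ur p a b u uL uR U UL UR) {x t : ℝ} (ht : 0 < t) :
    u x t = uR x t + (uL x t - uR x t) * logistic a b ((UL x t - UR x t) / (2 * ν)) := by
  have h1 := h.potential.hasDerivAt_coleHopf (x := x) ht
  have h2 := ((h.potential_left.hasDerivAt_coleHopf (x := x) ht).const_mul a).add
    ((h.potential_right.hasDerivAt_coleHopf (x := x) ht).const_mul b)
  have h3 : (fun y => coleHopf ν U y t)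
      = (fun y => a * coleHopf ν UL y t) + fun y => b * coleHopf ν UR y t :=
    funext fun y => h.superposition y t ht.le
  rw [h3] at h1
  -- The space derivative of the superposition, still to be divided by the transform of `uL`.
  have h4 := h1.unique h2
  rw [h.superposition x t ht.le] at h4
  have hR : coleHopf ν UR x t
      = Real.exp ((UL x t - UR x t) / (2 * ν)) * coleHopf ν UL x t := by
    simp only [coleHopf]
    rw [← Real.exp_add]; congr 1; ring
  rw [hR] at h4
  have hpos := coleHopf_pos ν UL x t
  have he := Real.exp_pos ((UL x t - UR x t) / (2 * ν))
  set e := Real.exp ((UL x t - UR x t) / (2 * ν))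
  set q := coleHopf ν UL x t
  have h5 : u x t * (a + b * e) = a * uL x t + b * e * uR x t := by
    field_simp at h4
    linarith
  have hne : a + b * e ≠ 0 := by positivity
  unfold logistic
  rw [eq_comm, ← sub_eq_zero]
  field_simp
  linarith

lemma IsShockTriple.shift_right (h : IsShockTriple ν ul ur p a b u uL uR U UL UR) {t : ℝ}
    (ht : 0 ≤ t) (x : ℝ) (k : ℕ) : UR x t = UR (x - k * p) t + ur * (k * p) := by
  induction k with
  | zero => simp
  | succ k ih =>
    rw [ih, h.periodic_right _ t ht]
    push_cast
    rw [show x - k * p - p = x - (k + 1) * p by ring]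
    ring

/-- At the resonant times the potentials of the periodic solutions differ by a linear function. -/
lemma IsShockTriple.sub_eq_of_resonant (hu : ur < ul)
    (h : IsShockTriple ν ul ur p a b u uL uR U UL UR) {t : ℝ} (ht : 0 ≤ t) {k : ℕ}
    (hk : k * p = (ul - ur) * t) (x : ℝ) :
    UL x t - UR x t = (ul - ur) * (x - shockSpeed burgersFlux ul ur * t) := by
  rw [h.galilean x t ht, h.shift_right ht x k, hk, shockSpeed_burgersFlux hu]
  ring

/-- At the resonant times the solution is given by the ansatz. -/
theorem IsShockTriple.eq_ansatz (hν : 0 < ν) (hu : ur < ul) (ha : 0 < a) (hb : 0 < b)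
    (h : IsShockTriple ν ul ur p a b u uL uR U UL UR) {g : ℝ → ℝ}
    (hg : ∀ x, g x = logistic a b ((ul - ur) / (2 * ν) * x)) {t : ℝ} (ht : 0 < t) {k : ℕ}
    (hk : k * p = (ul - ur) * t) (x : ℝ) :
    u x t = ansatz uL uR g (shockSpeed burgersFlux ul ur * t) x t := by
  rw [h.eq_logistic hν ha hb ht, h.sub_eq_of_resonant hu ht.le hk, ansatz, hg,
    mul_div_right_comm]
  ring

end Triple

/-! ### Exponential decay and integrability of the weight -/

section Decay

lemma integrable_exp_neg_mul_abs {β : ℝ} (hβ : 0 < β) :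
    Integrable (fun x : ℝ => Real.exp (-β * |x|)) := by
  rw [← integrableOn_univ, ← Iic_union_Ioi (a := (0 : ℝ))]
  refine IntegrableOn.union ?_ ?_
  · refine (integrableOn_exp_mul_Iic hβ 0).congr_fun (fun x hx => ?_) measurableSet_Iic
    simp only [abs_of_nonpos (mem_Iic.1 hx), neg_mul_neg]
  · refine (integrableOn_exp_mul_Ioi (neg_lt_zero.2 hβ) 0).congr_fun (fun x hx => ?_)
      measurableSet_Ioi
    simp only [abs_of_pos (mem_Ioi.1 hx)]

/-- Half of the decay rate is given up to absorb the linear factor. -/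
lemma one_add_abs_mul_exp_le {β : ℝ} (hβ : 0 < β) (x : ℝ) :
    (1 + |x|) * Real.exp (-β * |x|) ≤ (1 + 2 / β) * Real.exp (-(β / 2) * |x|) := by
  have h1 : 1 + |x| ≤ (1 + 2 / β) * Real.exp (β / 2 * |x|) := by
    have h2 := Real.add_one_le_exp (β / 2 * |x|)
    have h3 : |x| = 2 / β * (β / 2 * |x|) := by field_simp
    have h4 : 0 ≤ β / 2 * |x| := by positivity
    have h5 : 0 < 2 / β := by positivity
    calc 1 + |x| = 1 + 2 / β * (β / 2 * |x|) := by rw [← h3]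
      _ ≤ (1 + 2 / β) * (β / 2 * |x| + 1) := by nlinarith
      _ ≤ _ := mul_le_mul_of_nonneg_left h2 (by positivity)
  calc _ ≤ (1 + 2 / β) * Real.exp (β / 2 * |x|) * Real.exp (-β * |x|) :=
        mul_le_mul_of_nonneg_right h1 (Real.exp_pos _).le
    _ = _ := by rw [mul_assoc, ← Real.exp_add]; congr 2; ring

lemma tendsto_const_mul_exp_neg_mul_abs {β : ℝ} (hβ : 0 < β) {l : Filter ℝ}
    (hl : Tendsto (fun x : ℝ => |x|) l atTop) (A : ℝ) :
    Tendsto (fun x : ℝ => A * Real.exp (-β * |x|)) l (𝓝 0) := by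
  have h := (Real.tendsto_exp_atBot.comp
    (hl.const_mul_atTop_of_neg (neg_lt_zero.2 hβ))).const_mul A
  rwa [mul_zero] at h

end Decay

section Logistic

variable {a b : ℝ} (ha : 0 < a) (hb : 0 < b)
include ha hb

lemma continuous_logistic : Continuous (logistic a b) :=
  continuous_iff_continuousAt.2 fun y => (hasDerivAt_logistic ha hb y).continuousAt

/-- Exponential decay of `logistic` in both directions along perturbations of a linear function. -/
lemma logistic_le_of_near {β B x y : ℝ} (hx : 0 ≤ x) (hy : |y - β * x| ≤ B) :
    logistic a b y ≤ (a / b + b / a) * Real.exp B * Real.exp (-β * |x|) := by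
  have h1 := (abs_le.1 hy).1
  calc logistic a b y ≤ a / b * Real.exp (-y) := logistic_le ha hb y
    _ ≤ (a / b + b / a) * Real.exp (B + -β * |x|) := by
      refine mul_le_mul ?_ ?_ (Real.exp_pos _).le (by positivity)
      · have : 0 < b / a := by positivity
        linarith
      · rw [abs_of_nonneg hx, Real.exp_le_exp]; linarith
    _ = _ := by rw [Real.exp_add]; ring

lemma one_sub_logistic_le_of_near {β B x y : ℝ} (hx : x ≤ 0) (hy : |y - β * x| ≤ B) :
    1 - logistic a b y ≤ (a / b + b / a) * Real.exp B * Real.exp (-β * |x|) := by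
  have h1 := (abs_le.1 hy).2
  calc 1 - logistic a b y ≤ b / a * Real.exp y := one_sub_logistic_le ha hb y
    _ ≤ (a / b + b / a) * Real.exp (B + -β * |x|) := by
      refine mul_le_mul ?_ ?_ (Real.exp_pos _).le (by positivity)
      · have : 0 < a / b := by positivity
        linarith
      · rw [abs_of_nonpos hx, Real.exp_le_exp]; linarith
    _ = _ := by rw [Real.exp_add]; ring

lemma abs_logistic_sub_le {β B x y y' : ℝ} (hy : |y - β * x| ≤ B) (hy' : |y' - β * x| ≤ B) :
    |logistic a b y - logistic a b y'| ≤ (a / b + b / a) * Real.exp B * Real.exp (-β * |x|) := by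
  have p1 := logistic_pos ha hb y
  have p2 := logistic_pos ha hb y'
  have p3 := logistic_lt_one ha hb y
  have p4 := logistic_lt_one ha hb y'
  rcases le_total 0 x with hx | hx
  · have h1 := logistic_le_of_near ha hb hx hy
    have h2 := logistic_le_of_near ha hb hx hy'
    rw [abs_le]; constructor <;> linarith
  · have h1 := one_sub_logistic_le_of_near ha hb hx hy
    have h2 := one_sub_logistic_le_of_near ha hb hx hy'
    rw [abs_le]; constructor <;> linarith

lemma logistic_mul_one_sub_le {β B x y : ℝ} (hy : |y - β * x| ≤ B) :
    logistic a b y * (1 - logistic a b y)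
      ≤ (a / b + b / a) * Real.exp B * Real.exp (-β * |x|) := by
  have p1 := logistic_pos ha hb y
  have p3 := logistic_lt_one ha hb y
  rcases le_total 0 x with hx | hx
  · have h1 := logistic_le_of_near ha hb hx hy
    nlinarith
  · have h1 := one_sub_logistic_le_of_near ha hb hx hy
    nlinarith

end Logistic

/-- The derivative of the weight `x ↦ logistic a b (β x)`. -/
noncomputable def logisticDeriv (a b β x : ℝ) : ℝ :=
  -β * (logistic a b (β * x) * (1 - logistic a b (β * x)))

section Weight

variable {a b β : ℝ} (ha : 0 < a) (hb : 0 < b) (hβ : 0 < β)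
include ha hb

lemma hasDerivAt_logistic_mul (x : ℝ) :
    HasDerivAt (fun x => logistic a b (β * x)) (logisticDeriv a b β x) x := by
  have := (hasDerivAt_logistic ha hb (β * x)).comp x ((hasDerivAt_id x).const_mul β)
  exact this.congr_deriv (by unfold logisticDeriv; ring)

lemma hasDerivAt_logisticDeriv (x : ℝ) :
    HasDerivAt (logisticDeriv a b β)
      (-β * (1 - 2 * logistic a b (β * x)) * logisticDeriv a b β x) x := by
  have h := hasDerivAt_logistic_mul ha hb (β := β) x
  have := (h.mul (h.const_sub 1)).const_mul (-β)
  refine HasDerivAt.congr_deriv (f := logisticDeriv a b β) this ?_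
  ring

lemma continuous_logisticDeriv : Continuous (logisticDeriv a b β) :=
  continuous_iff_continuousAt.2 fun y => (hasDerivAt_logisticDeriv ha hb y).continuousAt

include hβ

lemma logisticDeriv_neg (x : ℝ) : logisticDeriv a b β x < 0 := by
  have p1 := logistic_pos ha hb (β * x)
  have p3 := logistic_lt_one ha hb (β * x)
  have : 0 < β * (logistic a b (β * x) * (1 - logistic a b (β * x))) :=
    mul_pos hβ (mul_pos p1 (by linarith))
  unfold logisticDeriv
  linarith

/-- A bound for the derivative of the weight, uniform over shifts in a bounded set. -/
lemma abs_logisticDeriv_sub_le (ξ x : ℝ) :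
    |logisticDeriv a b β (x - ξ)|
      ≤ β * ((a / b + b / a) * Real.exp (β * |ξ|)) * Real.exp (-β * |x|) := by
  rw [abs_of_neg (logisticDeriv_neg ha hb hβ _), logisticDeriv, neg_mul, neg_neg, mul_assoc β]
  refine mul_le_mul_of_nonneg_left (logistic_mul_one_sub_le ha hb ?_) hβ.le
  rw [mul_sub, sub_sub_cancel_left, abs_neg, abs_mul, abs_of_pos hβ]

lemma integrable_logisticDeriv : Integrable (logisticDeriv a b β) := by
  refine ((integrable_exp_neg_mul_abs hβ).const_mul
    (β * ((a / b + b / a) * Real.exp (β * |0|)))).mono'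
    (continuous_logisticDeriv ha hb).aestronglyMeasurable (Eventually.of_forall fun x => ?_)
  simpa using abs_logisticDeriv_sub_le ha hb hβ 0 x

lemma integrable_of_linear_growth {D : ℝ → ℝ} (hD : Continuous D) {C : ℝ}
    (hC : ∀ x, |D x| ≤ C * (1 + |x|)) (ξ : ℝ) :
    Integrable (fun x => D x * logisticDeriv a b β (x - ξ)) := by
  have hcont := continuous_logisticDeriv ha hb (β := β)
  have hC0 : 0 ≤ C := by
    have := (abs_nonneg _).trans (hC 0)
    simpa using this
  set A := β * ((a / b + b / a) * Real.exp (β * |ξ|)) with hA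
  have hA0 : 0 ≤ A := by positivity
  refine ((integrable_exp_neg_mul_abs (half_pos hβ)).const_mul
    (C * A * (1 + 2 / β))).mono' (by fun_prop) (Eventually.of_forall fun x => ?_)
  rw [norm_mul]
  calc ‖D x‖ * ‖logisticDeriv a b β (x - ξ)‖ ≤ C * (1 + |x|) * (A * Real.exp (-β * |x|)) :=
        mul_le_mul (hC x) (abs_logisticDeriv_sub_le ha hb hβ ξ x) (norm_nonneg _) (by positivity)
    _ = C * A * ((1 + |x|) * Real.exp (-β * |x|)) := by ring
    _ ≤ C * A * ((1 + 2 / β) * Real.exp (-(β / 2) * |x|)) :=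
        mul_le_mul_of_nonneg_left (one_add_abs_mul_exp_le hβ x) (by positivity)
    _ = _ := by ring

lemma tendsto_logistic_atTop : Tendsto (fun x => logistic a b (β * x)) atTop (𝓝 0) := by
  refine squeeze_zero' (Eventually.of_forall fun x => (logistic_pos ha hb _).le) ?_
    (tendsto_const_mul_exp_neg_mul_abs hβ tendsto_abs_atTop_atTop ((a / b + b / a) * Real.exp 0))
  filter_upwards [eventually_ge_atTop 0] with x hx
  exact logistic_le_of_near ha hb hx (by simp)

lemma tendsto_logistic_atBot : Tendsto (fun x => logistic a b (β * x)) atBot (𝓝 1) := by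
  have h : Tendsto (fun x => 1 - logistic a b (β * x)) atBot (𝓝 0) := by
    refine squeeze_zero' (Eventually.of_forall fun x => ?_) ?_
      (tendsto_const_mul_exp_neg_mul_abs hβ tendsto_abs_atBot_atTop ((a / b + b / a) * Real.exp 0))
    · linarith [logistic_lt_one ha hb (β * x)]
    · filter_upwards [eventually_le_atBot 0] with x hx
      exact one_sub_logistic_le_of_near ha hb hx (by simp)
  simpa using h.const_sub 1

/-- The weight falls from `1` to `0`. This value later fixes the slope of the mass in the shift, and
keeps the denominator of `shiftField` away from zero. -/
lemma integral_logisticDeriv : ∫ x, logisticDeriv a b β x = -1 := by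
  rw [integral_of_hasDerivAt_of_tendsto (hasDerivAt_logistic_mul ha hb)
    (integrable_logisticDeriv ha hb hβ) (tendsto_logistic_atBot ha hb hβ)
    (tendsto_logistic_atTop ha hb hβ)]
  ring

end Weight

/-- A function that is continuous for positive times and periodic in space is bounded, locally
uniformly in time. -/
lemma exists_bound_of_periodic {f : ℝ → ℝ → ℝ} {p : ℝ} (hp : 0 < p)
    (hf : ContinuousOn (fun z : ℝ × ℝ => f z.1 z.2) {z : ℝ × ℝ | 0 < z.2})
    (hper : ∀ t, 0 < t → Function.Periodic (fun x => f x t) p) {t₁ : ℝ} (ht₁ : 0 < t₁) (t₂ : ℝ) :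
    ∃ C, 0 ≤ C ∧ ∀ x t, t₁ ≤ t → t ≤ t₂ → |f x t| ≤ C := by
  obtain ⟨C, hC⟩ := ((isCompact_Icc (a := (0 : ℝ)) (b := p)).prod
    (isCompact_Icc (a := t₁) (b := t₂))).exists_bound_of_continuousOn
    (hf.mono fun z hz => ht₁.trans_le hz.2.1)
  refine ⟨|C|, abs_nonneg C, fun x t h1 h2 => ?_⟩
  obtain ⟨y, hy, hxy⟩ := (hper t (ht₁.trans_le h1)).exists_mem_Ico₀ hp x
  have := hC (y, t) ⟨⟨hy.1, hy.2.le⟩, h1, h2⟩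
  rw [show f x t = f y t from hxy]
  exact this.trans (le_abs_self C)

/-! ### The excess mass over the ansatz -/

section Mass

variable {ν ul ur p a b : ℝ} {u uL uR U UL UR : ℝ → ℝ → ℝ}

/-- The potential is periodic up to an additive constant, which differentiation in space removes. -/
lemma IsPotential.periodic {v V : ℝ → ℝ → ℝ} {V₀ : ℝ → ℝ} {r : ℝ} (hV : IsPotential ν v V₀ V)
    (h : ∀ x t, 0 ≤ t → V x t = V (x - p) t + r * p) {t : ℝ} (ht : 0 < t) :
    Function.Periodic (fun x => v x t) p := by
  intro x
  have h1 : HasDerivAt (fun y => V (y + p) t) (v (x + p) t) x :=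
    (hV.hasDerivAt_fst (x := x + p) ht).comp_add_const x p
  have h2 : (fun y => V (y + p) t) = fun y => V y t + r * p :=
    funext fun y => by rw [h _ t ht.le, add_sub_cancel_right]
  rw [h2] at h1
  exact h1.unique ((hV.hasDerivAt_fst ht).add_const _)

lemma burgersRate_periodic {v : ℝ → ℝ → ℝ} {t : ℝ} (h : Function.Periodic (fun x => v x t) p) :
    Function.Periodic (fun x => burgersRate ν v x t) p := by
  intro x
  have h1 : deriv (fun y => v y t) (x + p) = deriv (fun y => v y t) x := by
    rw [← deriv_comp_add_const (f := fun y => v y t)]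
    congr 1
    exact funext h
  have h2 : v (x + p) t = v x t := h x
  simp only [burgersRate, h1, h2]

variable (h : IsShockTriple ν ul ur p a b u uL uR U UL UR)
include h

lemma IsShockTriple.continuousOn_sub :
    ContinuousOn (fun z : ℝ × ℝ => UL z.1 z.2 - UR z.1 z.2) {z : ℝ × ℝ | 0 < z.2} :=
  (h.potential_left.continuousOn.sub h.potential_right.continuousOn).mono fun z hz =>
    le_of_lt (show 0 < z.2 from hz)

lemma IsShockTriple.continuous_sub {t : ℝ} (ht : 0 < t) :
    Continuous (fun x => UL x t - UR x t) :=
  continuous_slice (f := fun x t => UL x t - UR x t) h.continuousOn_sub ht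

/-- The potential difference stays close to a linear function. -/
lemma IsShockTriple.exists_bound_sub (hp : 0 < p) {t₁ : ℝ} (ht₁ : 0 < t₁) (t₂ : ℝ) :
    ∃ C, 0 ≤ C ∧ ∀ x t, t₁ ≤ t → t ≤ t₂ → |UL x t - UR x t - (ul - ur) * x| ≤ C := by
  refine exists_bound_of_periodic (f := fun x t => UL x t - UR x t - (ul - ur) * x) hp
    (h.continuousOn_sub.sub (by fun_prop)) (fun t ht x => ?_) ht₁ t₂
  have h1 := h.periodic_left (x + p) t ht.le
  have h2 := h.periodic_right (x + p) t ht.le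
  rw [add_sub_cancel_right] at h1 h2
  simp only [h1, h2]
  ring

lemma IsShockTriple.exists_linear_growth (hp : 0 < p) {t₁ : ℝ} (ht₁ : 0 < t₁) (t₂ : ℝ) :
    ∃ C, 0 ≤ C ∧ ∀ x t, t₁ ≤ t → t ≤ t₂ → |UL x t - UR x t| ≤ C * (1 + |x|) := by
  obtain ⟨C, hC0, hC⟩ := h.exists_bound_sub hp ht₁ t₂
  refine ⟨C + |ul - ur|, by positivity, fun x t h1 h2 => ?_⟩
  have := abs_add_le (UL x t - UR x t - (ul - ur) * x) ((ul - ur) * x)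
  rw [sub_add_cancel, abs_mul] at this
  nlinarith [hC x t h1 h2, abs_nonneg x, abs_nonneg (ul - ur)]

lemma IsShockTriple.hasDerivAt_sub {x t : ℝ} (ht : 0 < t) :
    HasDerivAt (fun y => UL y t - UR y t) (uL x t - uR x t) x :=
  (h.potential_left.hasDerivAt_fst ht).sub (h.potential_right.hasDerivAt_fst ht)

/-- The excess mass of `u` over the ansatz, in terms of the potentials of the periodic solutions. -/
theorem IsShockTriple.integral_sub_ansatz (hν : 0 < ν) (hu : ur < ul) (hp : 0 < p)
    (ha : 0 < a) (hb : 0 < b) {M : ℝ} {t : ℝ} (ht : 0 < t)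
    (hcu : Continuous (fun x => uL x t - uR x t)) (hM : ∀ x, |uL x t - uR x t| ≤ M)
    {g : ℝ → ℝ} (hg : ∀ x, g x = logistic a b ((ul - ur) / (2 * ν) * x)) (ξ : ℝ) :
    ∫ x, (u x t - ansatz uL uR g ξ x t) = 2 * ν * Real.log a - 2 * ν * Real.log b
      + ∫ y, (UL (y + ξ) t - UR (y + ξ) t) * logisticDeriv a b ((ul - ur) / (2 * ν)) y := by
  set β := (ul - ur) / (2 * ν) with hβ_def
  have hβ : 0 < β := div_pos (by linarith) (by positivity)
  obtain ⟨B, hB0, hB⟩ := h.exists_bound_sub hp ht t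
  obtain ⟨C, hC0, hC⟩ := h.exists_linear_growth hp ht t
  have hDc := h.continuous_sub ht
  have hlc := continuous_logistic ha hb
  set D : ℝ → ℝ := fun x => UL x t - UR x t with hD
  set δ : ℝ → ℝ := fun x => uL x t - uR x t with hδ
  have hM0 : 0 ≤ M := (abs_nonneg _).trans (hM 0)
  set B' := max (B / (2 * ν)) (β * |ξ|)
  have near1 : ∀ x, |D x / (2 * ν) - β * x| ≤ B' := fun x => by
    refine le_trans (le_of_eq ?_) ((div_le_div_of_nonneg_right (hB x t le_rfl le_rfl)
      (by positivity : 0 ≤ 2 * ν)).trans (le_max_left _ _))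
    rw [← abs_of_pos (by positivity : 0 < 2 * ν), ← abs_div, abs_of_pos (by positivity : 0 < 2 * ν)]
    congr 1
    rw [hβ_def, hD]
    field_simp
  have near2 : ∀ x, |β * (x - ξ) - β * x| ≤ B' := fun x => by
    rw [mul_sub, sub_sub_cancel_left, abs_neg, abs_mul, abs_of_pos hβ]
    exact le_max_right _ _
  have hud : ∀ x, u x t - ansatz uL uR g ξ x t
      = δ x * (logistic a b (D x / (2 * ν)) - logistic a b (β * (x - ξ))) := fun x => by
    rw [h.eq_logistic hν ha hb ht, ansatz, hg]
    simp only [hδ, hD]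
    ring
  have hint : Integrable (fun x => u x t - ansatz uL uR g ξ x t) := by
    refine ((integrable_exp_neg_mul_abs hβ).const_mul
      (M * ((a / b + b / a) * Real.exp B'))).mono' ?_ (Eventually.of_forall fun x => ?_)
    · simp only [hud]
      fun_prop
    · rw [hud, norm_mul, mul_assoc M]
      exact mul_le_mul (hM x) (abs_logistic_sub_le ha hb (near1 x) (near2 x)) (norm_nonneg _) hM0
  have hDg : Integrable (fun x => D x * logisticDeriv a b β (x - ξ)) :=
    integrable_of_linear_growth ha hb hβ hDc (fun x => hC x t le_rfl le_rfl) ξ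
  -- Integration by parts in explicit form: the integrand, corrected by `D g'`, has this primitive,
  -- so only its limits at `±∞` matter.
  have hder : ∀ x, HasDerivAt (fun x => U x t - UR x t - D x * logistic a b (β * (x - ξ)))
      (u x t - ansatz uL uR g ξ x t - D x * logisticDeriv a b β (x - ξ)) x := fun x => by
    refine (((h.potential.hasDerivAt_fst ht).sub (h.potential_right.hasDerivAt_fst ht)).sub
      ((h.hasDerivAt_sub ht).mul
        ((hasDerivAt_logistic_mul ha hb (β := β) (x - ξ)).comp_sub_const x ξ))).congr_deriv ?_
    rw [ansatz, hg]
    simp only [hD]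
    ring
  have hUR : ∀ x, U x t - UR x t
      = -(2 * ν) * Real.log (b + a * Real.exp (-(D x / (2 * ν)))) := fun x => by
    have h1 : b + a * Real.exp (-(D x / (2 * ν))) = coleHopf ν U x t / coleHopf ν UR x t := by
      rw [h.superposition x t ht.le, add_div, mul_div_cancel_right₀ _ (coleHopf_pos _ _ _ _).ne',
        add_comm, mul_div_assoc]
      simp only [coleHopf, hD]
      rw [← Real.exp_sub]
      congr 3; ring
    rw [h1]
    simp only [coleHopf]
    rw [← Real.exp_sub, Real.log_exp]
    field_simp
    ring
  have hUL : ∀ x, U x t - UL x t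
      = -(2 * ν) * Real.log (a + b * Real.exp (D x / (2 * ν))) := fun x => by
    have h1 : a + b * Real.exp (D x / (2 * ν)) = coleHopf ν U x t / coleHopf ν UL x t := by
      rw [h.superposition x t ht.le, add_div, mul_div_cancel_right₀ _ (coleHopf_pos _ _ _ _).ne',
        mul_div_assoc]
      simp only [coleHopf, hD]
      rw [← Real.exp_sub]
      congr 3; ring
    rw [h1]
    simp only [coleHopf]
    rw [← Real.exp_sub, Real.log_exp]
    field_simp
    ring
  have hDdecay : ∀ {l : Filter ℝ}, Tendsto (fun x : ℝ => |x|) l atTop →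
      Tendsto (fun x : ℝ => C * ((a / b + b / a) * Real.exp B') * (1 + 2 / β)
        * Real.exp (-(β / 2) * |x|)) l (𝓝 0) := fun hl =>
    tendsto_const_mul_exp_neg_mul_abs (half_pos hβ) hl _
  have hmulbound : ∀ x v : ℝ, |v| ≤ (a / b + b / a) * Real.exp B' * Real.exp (-β * |x|) →
      ‖D x * v‖ ≤ C * ((a / b + b / a) * Real.exp B') * (1 + 2 / β)
        * Real.exp (-(β / 2) * |x|) := fun x v hv => by
    rw [norm_mul]
    calc ‖D x‖ * ‖v‖ ≤ C * (1 + |x|) * ((a / b + b / a) * Real.exp B' * Real.exp (-β * |x|)) :=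
          mul_le_mul (hC x t le_rfl le_rfl) hv (norm_nonneg _) (by positivity)
      _ = C * ((a / b + b / a) * Real.exp B') * ((1 + |x|) * Real.exp (-β * |x|)) := by ring
      _ ≤ C * ((a / b + b / a) * Real.exp B') * ((1 + 2 / β) * Real.exp (-(β / 2) * |x|)) :=
          mul_le_mul_of_nonneg_left (one_add_abs_mul_exp_le hβ x) (by positivity)
      _ = _ := by ring
  have htop : Tendsto (fun x => U x t - UR x t - D x * logistic a b (β * (x - ξ))) atTop
      (𝓝 (-(2 * ν) * Real.log b - 0)) := by
    refine Tendsto.sub ?_ ?_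
    · simp only [hUR]
      refine Tendsto.const_mul _ ?_
      have h1 : Tendsto (fun x => Real.exp (-(D x / (2 * ν)))) atTop (𝓝 0) := by
        refine squeeze_zero' (Eventually.of_forall fun x => (Real.exp_pos _).le) ?_
          (tendsto_const_mul_exp_neg_mul_abs hβ tendsto_abs_atTop_atTop (Real.exp B'))
        filter_upwards [eventually_ge_atTop 0] with x hx
        rw [← Real.exp_add, abs_of_nonneg hx, Real.exp_le_exp]
        linarith [(abs_le.1 (near1 x)).1]
      have h2 : Tendsto (fun x => b + a * Real.exp (-(D x / (2 * ν)))) atTop (𝓝 b) := by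
        simpa using (h1.const_mul a).const_add b
      exact h2.log hb.ne'
    · refine squeeze_zero_norm' ?_ (hDdecay tendsto_abs_atTop_atTop)
      filter_upwards [eventually_ge_atTop 0] with x hx
      refine hmulbound x _ ?_
      rw [abs_of_pos (logistic_pos ha hb _)]
      exact logistic_le_of_near ha hb hx (near2 x)
  have hbot : Tendsto (fun x => U x t - UR x t - D x * logistic a b (β * (x - ξ))) atBot
      (𝓝 (-(2 * ν) * Real.log a + 0)) := by
    -- At `-∞` both `U - UR` and `D g` diverge; comparing with `UL` instead makes each term
    -- converge.
    have hsplit : ∀ x, U x t - UR x t - D x * logistic a b (β * (x - ξ))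
        = (U x t - UL x t) + D x * (1 - logistic a b (β * (x - ξ))) := fun x => by
      simp only [hD]; ring
    simp only [hsplit]
    refine Tendsto.add ?_ ?_
    · simp only [hUL]
      refine Tendsto.const_mul _ ?_
      have h1 : Tendsto (fun x => Real.exp (D x / (2 * ν))) atBot (𝓝 0) := by
        refine squeeze_zero' (Eventually.of_forall fun x => (Real.exp_pos _).le) ?_
          (tendsto_const_mul_exp_neg_mul_abs hβ tendsto_abs_atBot_atTop (Real.exp B'))
        filter_upwards [eventually_le_atBot 0] with x hx
        rw [← Real.exp_add, abs_of_nonpos hx, Real.exp_le_exp]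
        linarith [(abs_le.1 (near1 x)).2]
      have h2 : Tendsto (fun x => a + b * Real.exp (D x / (2 * ν))) atBot (𝓝 a) := by
        simpa using (h1.const_mul b).const_add a
      exact h2.log ha.ne'
    · refine squeeze_zero_norm' ?_ (hDdecay tendsto_abs_atBot_atTop)
      filter_upwards [eventually_le_atBot 0] with x hx
      refine hmulbound x _ ?_
      rw [abs_of_pos (by linarith [logistic_lt_one ha hb (β * (x - ξ))])]
      exact one_sub_logistic_le_of_near ha hb hx (near2 x)
  have key := integral_of_hasDerivAt_of_tendsto hder (hint.sub hDg) hbot htop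
  rw [integral_sub hint hDg] at key
  have hshift : ∫ y, D (y + ξ) * logisticDeriv a b β y
      = ∫ x, D x * logisticDeriv a b β (x - ξ) := by
    rw [← integral_sub_right_eq_self _ ξ]
    simp only [sub_add_cancel]
  have : ∫ y, (UL (y + ξ) t - UR (y + ξ) t) * logisticDeriv a b β y
      = ∫ y, D (y + ξ) * logisticDeriv a b β y := rfl
  rw [this, hshift]
  linarith

end Mass

/-! ### Conservation of the excess mass along the shift -/

section Shift

variable {ν ul ur p a b : ℝ} {u uL uR U UL UR : ℝ → ℝ → ℝ} {u₀L u₀R : ℝ → ℝ}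

/-- The part of the excess mass that depends on the shift `ξ`. -/
noncomputable def shiftMass (β a b : ℝ) (UL UR : ℝ → ℝ → ℝ) (ξ t : ℝ) : ℝ :=
  ∫ y, (UL (y + ξ) t - UR (y + ξ) t) * logisticDeriv a b β y

lemma IsShockTriple.integrable_shift (h : IsShockTriple ν ul ur p a b u uL uR U UL UR)
    (hp : 0 < p) (ha : 0 < a) (hb : 0 < b) {β : ℝ} (hβ : 0 < β) {t : ℝ} (ht : 0 < t) (ξ : ℝ) :
    Integrable (fun y => (UL (y + ξ) t - UR (y + ξ) t) * logisticDeriv a b β y) := by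
  obtain ⟨C, -, hC⟩ := h.exists_linear_growth hp ht t
  have := (integrable_of_linear_growth ha hb hβ (h.continuous_sub ht)
    (fun x => hC x t le_rfl le_rfl) ξ).comp_add_right ξ
  simpa only [add_sub_cancel_right] using this

lemma integrable_mul_logisticDeriv (ha : 0 < a) (hb : 0 < b) {β : ℝ} (hβ : 0 < β) {f : ℝ → ℝ}
    (hf : Continuous f) {M : ℝ} (hM : ∀ x, |f x| ≤ M) (ξ : ℝ) :
    Integrable (fun x => f x * logisticDeriv a b β (x - ξ)) :=
  ((integrable_logisticDeriv ha hb hβ).comp_sub_right ξ).bdd_mul hf.aestronglyMeasurable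
    (Eventually.of_forall hM)

/-- In the variable `y = x - ξ` the weight is fixed, and `(ξ, t)` enters only through the
potentials. The gradient of their difference is bounded, by periodicity, on a time strip around `t`,
so an integrable multiple of the weight's derivative dominates; then the chain rule applies along
`(X(t), t)`. -/
lemma IsShockTriple.hasDerivAt_shiftMass (h : IsShockTriple ν ul ur p a b u uL uR U UL UR)
    (hL : IsBoundedSolution burgersFlux ν u₀L uL) (hR : IsBoundedSolution burgersFlux ν u₀R uR)
    (hp : 0 < p) (ha : 0 < a) (hb : 0 < b) {β : ℝ} (hβ : 0 < β) {X : ℝ → ℝ} {X' t : ℝ}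
    (ht : 0 < t) (hX : HasDerivAt X X' t) :
    HasDerivAt (fun t => shiftMass β a b UL UR (X t) t)
      (∫ x, ((uL x t - uR x t) * X' + (burgersRate ν uL x t - burgersRate ν uR x t))
        * logisticDeriv a b β (x - X t)) t := by
  have hδc : ContinuousOn (fun z : ℝ × ℝ => uL z.1 z.2 - uR z.1 z.2) {z : ℝ × ℝ | 0 < z.2} :=
    hL.continuousOn.sub hR.continuousOn
  have hrc : ContinuousOn (fun z : ℝ × ℝ => burgersRate ν uL z.1 z.2 - burgersRate ν uR z.1 z.2)
      {z : ℝ × ℝ | 0 < z.2} := hL.continuousOn_burgersRate.sub hR.continuousOn_burgersRate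
  have hLp := fun t ht => h.potential_left.periodic h.periodic_left (t := t) ht
  have hRp := fun t ht => h.potential_right.periodic h.periodic_right (t := t) ht
  obtain ⟨M, hM0, hM⟩ := exists_bound_of_periodic (f := fun x t => uL x t - uR x t) hp hδc
    (fun t ht => (hLp t ht).sub (hRp t ht)) (half_pos ht) (2 * t)
  obtain ⟨Q, hQ0, hQ⟩ := exists_bound_of_periodic
    (f := fun x t => burgersRate ν uL x t - burgersRate ν uR x t) hp hrc
    (fun t ht => (burgersRate_periodic (hLp t ht)).sub (burgersRate_periodic (hRp t ht)))
    (half_pos ht) (2 * t)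
  set L : ℝ → ℝ → (ℝ × ℝ →L[ℝ] ℝ) := fun x t =>
    (uL x t - uR x t) • ContinuousLinearMap.fst ℝ ℝ ℝ
      + (burgersRate ν uL x t - burgersRate ν uR x t) • ContinuousLinearMap.snd ℝ ℝ ℝ with hLdef
  have hgc := continuous_logisticDeriv ha hb (β := β)
  have hδt := continuous_slice (f := fun x t => uL x t - uR x t) hδc ht
  have hrt := continuous_slice
    (f := fun x t => burgersRate ν uL x t - burgersRate ν uR x t) hrc ht
  set s : Set (ℝ × ℝ) := univ ×ˢ Icc (t / 2) (2 * t) with hs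
  have hsn : s ∈ 𝓝 (X t, t) :=
    prod_mem_nhds univ_mem (Icc_mem_nhds (by linarith) (by linarith))
  have hpos : ∀ z ∈ s, 0 < z.2 := fun z hz => (half_pos ht).trans_le hz.2.1
  set F' : ℝ × ℝ → ℝ → (ℝ × ℝ →L[ℝ] ℝ) := fun z y => logisticDeriv a b β y • L (y + z.1) z.2
  have hbound : ∀ y, ∀ z ∈ s, ‖F' z y‖ ≤ |logisticDeriv a b β y| * (M + Q) := by
    intro y z hz
    rw [norm_smul]
    refine mul_le_mul_of_nonneg_left ?_ (norm_nonneg _)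
    refine (norm_add_le _ _).trans (add_le_add ?_ ?_)
    · rw [norm_smul]
      exact (mul_le_of_le_one_right (norm_nonneg _) (ContinuousLinearMap.norm_fst_le _ _ _)).trans
        (hM _ _ hz.2.1 hz.2.2)
    · rw [norm_smul]
      exact (mul_le_of_le_one_right (norm_nonneg _) (ContinuousLinearMap.norm_snd_le _ _ _)).trans
        (hQ _ _ hz.2.1 hz.2.2)
  have hbi : Integrable (fun y => |logisticDeriv a b β y| * (M + Q)) :=
    (integrable_logisticDeriv ha hb hβ).norm.mul_const _
  have hF'm : AEStronglyMeasurable (F' (X t, t)) volume := by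
    have : Continuous (F' (X t, t)) := by
      refine hgc.smul (Continuous.add ?_ ?_)
      · exact (hδt.comp (by fun_prop : Continuous fun y : ℝ => y + X t)).smul continuous_const
      · exact (hrt.comp (by fun_prop : Continuous fun y : ℝ => y + X t)).smul continuous_const
    exact this.aestronglyMeasurable
  have hK : HasFDerivAt (fun z : ℝ × ℝ => shiftMass β a b UL UR z.1 z.2)
      (∫ y, F' (X t, t) y) (X t, t) := by
    refine hasFDerivAt_integral_of_dominated_of_fderiv_le (𝕜 := ℝ)
      (F := fun z y => (UL (y + z.1) z.2 - UR (y + z.1) z.2) * logisticDeriv a b β y)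
      hsn ?_ ?_ hF'm (Eventually.of_forall hbound) hbi ?_
    · filter_upwards [hsn] with z hz
      exact (h.integrable_shift hp ha hb hβ (hpos z hz) z.1).aestronglyMeasurable
    · exact h.integrable_shift hp ha hb hβ ht (X t)
    · refine Eventually.of_forall fun y z hz => ?_
      have h1 : HasFDerivAt (fun z : ℝ × ℝ => (y + z.1, z.2))
          ((ContinuousLinearMap.fst ℝ ℝ ℝ).prod (ContinuousLinearMap.snd ℝ ℝ ℝ)) z :=
        (hasFDerivAt_fst.const_add y).prodMk hasFDerivAt_snd
      have h2 := (h.potential_left.hasFDerivAt (y + z.1) z.2 (hpos z hz)).comp z h1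
      have h3 := (h.potential_right.hasFDerivAt (y + z.1) z.2 (hpos z hz)).comp z h1
      refine ((h2.sub h3).mul_const (logisticDeriv a b β y)).congr_fderiv ?_
      ext <;> simp [F', hLdef]
  have hcomp := HasFDerivAt.comp_hasDerivAt (f := fun τ => (X τ, τ)) t hK
    (hX.prodMk (hasDerivAt_id t))
  refine hcomp.congr_deriv ?_
  have hF'i : Integrable (F' (X t, t)) :=
    hbi.mono' hF'm (Eventually.of_forall fun y => hbound y _ (mem_of_mem_nhds hsn))
  rw [ContinuousLinearMap.integral_apply hF'i, ← integral_sub_right_eq_self _ (X t)]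
  congr 1
  ext x
  simp [F', hLdef]
  ring

/-- The shift equation says that the excess mass is conserved. -/
lemma IsShockTriple.hasDerivAt_shiftMass_zero (h : IsShockTriple ν ul ur p a b u uL uR U UL UR)
    (hL : IsBoundedSolution burgersFlux ν u₀L uL) (hR : IsBoundedSolution burgersFlux ν u₀R uR)
    (hp : 0 < p) (ha : 0 < a) (hb : 0 < b) {β : ℝ} (hβ : 0 < β) {X : ℝ → ℝ} {t m : ℝ}
    (ht : 0 < t) (hm : 0 < m) (hlow : ∀ x, m ≤ uL x t - uR x t)
    (hX : HasDerivAt X (shiftField burgersFlux ν uL uR (fun x => logistic a b (β * x)) (X t) t) t) :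
    HasDerivAt (fun t => shiftMass β a b UL UR (X t) t) 0 t := by
  refine (h.hasDerivAt_shiftMass hL hR hp ha hb hβ ht hX).congr_deriv ?_
  set ξ := X t
  have hg1 : deriv (fun x => logistic a b (β * x)) = logisticDeriv a b β :=
    funext fun x => (hasDerivAt_logistic_mul ha hb x).deriv
  have hg2 : iteratedDeriv 2 (fun x => logistic a b (β * x))
      = fun x => -β * (1 - 2 * logistic a b (β * x)) * logisticDeriv a b β x := by
    rw [iteratedDeriv_succ, iteratedDeriv_one, hg1]
    exact funext fun x => (hasDerivAt_logisticDeriv ha hb x).deriv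
  have hgc := continuous_logisticDeriv ha hb (β := β)
  have hlc := continuous_logistic ha hb
  have hLp := h.potential_left.periodic h.periodic_left ht
  have hRp := h.potential_right.periodic h.periodic_right ht
  have hLc := continuous_slice hL.continuousOn ht
  have hRc := continuous_slice hR.continuousOn ht
  have hLxc := continuous_slice (f := fun x t => deriv (fun y => uL y t) x)
    (smooth_deriv_fst hL.smooth).continuousOn ht
  have hRxc := continuous_slice (f := fun x t => deriv (fun y => uR y t) x)
    (smooth_deriv_fst hR.smooth).continuousOn ht
  have hfc : Continuous burgersFlux := by unfold burgersFlux; fun_prop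
  obtain ⟨M₁, hM₁⟩ := hL.bounded
  obtain ⟨M₂, hM₂⟩ := hR.bounded
  have hδb : ∀ x, |uL x t - uR x t| ≤ M₁ + M₂ := fun x =>
    (abs_sub _ _).trans (add_le_add (hM₁ x t ht) (hM₂ x t ht))
  have hxper : ∀ {v : ℝ → ℝ → ℝ}, Function.Periodic (fun x => v x t) p →
      Function.Periodic (fun x => deriv (fun y => v y t) x) p := fun {v} hv x => by
    simp only
    rw [← deriv_comp_add_const (f := fun y => v y t)]
    congr 1
    exact funext hv
  have hbdd : ∀ {f : ℝ → ℝ}, Continuous f → Function.Periodic f p → ∃ C, ∀ x, |f x| ≤ C := by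
    intro f hf hfp
    obtain ⟨C, -, hC⟩ := exists_bound_of_periodic (f := fun x _ => f x) hp
      (hf.comp continuous_fst).continuousOn (fun _ _ => hfp) one_pos 1
    exact ⟨C, fun x => hC x 1 le_rfl le_rfl⟩
  have i1 : Integrable (fun x => (uL x t - uR x t) * logisticDeriv a b β (x - ξ)) :=
    integrable_mul_logisticDeriv ha hb hβ (hLc.sub hRc) hδb ξ
  have i2 : Integrable (fun x => (deriv (fun y => uL y t) x - deriv (fun y => uR y t) x)
      * logisticDeriv a b β (x - ξ)) := by
    obtain ⟨C, hC⟩ := hbdd (hLxc.sub hRxc) ((hxper hLp).sub (hxper hRp))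
    exact integrable_mul_logisticDeriv ha hb hβ (hLxc.sub hRxc) hC ξ
  have i3 : Integrable (fun x => (burgersFlux (uL x t) - burgersFlux (uR x t))
      * logisticDeriv a b β (x - ξ)) := by
    have hc : Continuous (fun x => burgersFlux (uL x t) - burgersFlux (uR x t)) :=
      (hfc.comp hLc).sub (hfc.comp hRc)
    obtain ⟨C, hC⟩ := hbdd hc ((hLp.comp burgersFlux).sub (hRp.comp burgersFlux))
    exact integrable_mul_logisticDeriv ha hb hβ hc hC ξ
  have i4 : Integrable (fun x => (uL x t - uR x t) *
      (-β * (1 - 2 * logistic a b (β * (x - ξ))) * logisticDeriv a b β (x - ξ))) := by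
    have hb1 : ∀ x, |-β * (1 - 2 * logistic a b (β * (x - ξ)))| ≤ β := fun x => by
      have p1 := logistic_pos ha hb (β * (x - ξ))
      have p2 := logistic_lt_one ha hb (β * (x - ξ))
      rw [abs_mul, abs_neg, abs_of_pos hβ]
      refine mul_le_of_le_one_right hβ.le (abs_le.2 ⟨by linarith, by linarith⟩)
    have := i1.bdd_mul (f := fun x => -β * (1 - 2 * logistic a b (β * (x - ξ))))
      (by fun_prop) (Eventually.of_forall hb1)
    refine this.congr (Eventually.of_forall fun x => ?_)
    simp only; ring
  -- Moving one derivative off `g''` turns the diffusive term of `shiftField` into the `ν u_x` part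
  -- of `burgersRate`, with opposite sign.
  have hparts : ∫ x, (uL x t - uR x t) *
      (-β * (1 - 2 * logistic a b (β * (x - ξ))) * logisticDeriv a b β (x - ξ))
      = -∫ x, (deriv (fun y => uL y t) x - deriv (fun y => uR y t) x)
        * logisticDeriv a b β (x - ξ) :=
    integral_mul_deriv_eq_deriv_mul_of_integrable
      (fun x _ => (hasDerivAt_fst hL.smooth ht).sub (hasDerivAt_fst hR.smooth ht))
      (fun x _ => (hasDerivAt_logisticDeriv ha hb (x - ξ)).comp_sub_const x ξ) i4 i2 i1
  have hden : ∫ x, (uL x t - uR x t) * logisticDeriv a b β (x - ξ) ≠ 0 := by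
    have h1 : ∫ x, (uL x t - uR x t) * logisticDeriv a b β (x - ξ)
        ≤ ∫ x, m * logisticDeriv a b β (x - ξ) := by
      refine integral_mono i1
        (((integrable_logisticDeriv ha hb hβ).comp_sub_right ξ).const_mul m) fun x => ?_
      exact mul_le_mul_of_nonpos_right (hlow x) (logisticDeriv_neg ha hb hβ _).le
    rw [integral_const_mul, integral_sub_right_eq_self (logisticDeriv a b β) ξ,
      integral_logisticDeriv ha hb hβ] at h1
    linarith
  set X' := shiftField burgersFlux ν uL uR (fun x => logistic a b (β * x)) ξ t with hX'
  have hsplit : ∫ x, ((uL x t - uR x t) * X' + (burgersRate ν uL x t - burgersRate ν uR x t))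
        * logisticDeriv a b β (x - ξ)
      = X' * (∫ x, (uL x t - uR x t) * logisticDeriv a b β (x - ξ))
        + (ν * (∫ x, (deriv (fun y => uL y t) x - deriv (fun y => uR y t) x)
            * logisticDeriv a b β (x - ξ))
          - ∫ x, (burgersFlux (uL x t) - burgersFlux (uR x t)) * logisticDeriv a b β (x - ξ)) := by
    have i5 : Integrable (fun x => ν * ((deriv (fun y => uL y t) x - deriv (fun y => uR y t) x)
        * logisticDeriv a b β (x - ξ))
        - (burgersFlux (uL x t) - burgersFlux (uR x t)) * logisticDeriv a b β (x - ξ)) :=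
      (i2.const_mul ν).sub i3
    rw [← integral_const_mul, ← integral_const_mul, ← integral_sub (i2.const_mul ν) i3,
      ← integral_add (i1.const_mul X') i5]
    congr 1
    ext x
    simp only [burgersRate, burgersFlux]
    ring
  have hnum : ∫ x, (ν * (uL x t - uR x t) *
        (-β * (1 - 2 * logistic a b (β * (x - ξ))) * logisticDeriv a b β (x - ξ))
        + (burgersFlux (uL x t) - burgersFlux (uR x t)) * logisticDeriv a b β (x - ξ))
      = -(ν * ∫ x, (deriv (fun y => uL y t) x - deriv (fun y => uR y t) x)
            * logisticDeriv a b β (x - ξ))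
          + ∫ x, (burgersFlux (uL x t) - burgersFlux (uR x t)) * logisticDeriv a b β (x - ξ) := by
    rw [← mul_neg, ← hparts, ← integral_const_mul, ← integral_add (i4.const_mul ν) i3]
    congr 1
    ext x
    ring
  have hXden : X' * (∫ x, (uL x t - uR x t) * logisticDeriv a b β (x - ξ))
      = ∫ x, (ν * (uL x t - uR x t) *
        (-β * (1 - 2 * logistic a b (β * (x - ξ))) * logisticDeriv a b β (x - ξ))
        + (burgersFlux (uL x t) - burgersFlux (uR x t)) * logisticDeriv a b β (x - ξ)) := by
    rw [hX', shiftField, hg1, hg2, div_mul_cancel₀ _ hden]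
  rw [hsplit, hXden, hnum]
  ring

/-- `shiftMass` is continuous along continuous curves of shifts. -/
lemma IsShockTriple.continuousOn_shiftMass (h : IsShockTriple ν ul ur p a b u uL uR U UL UR)
    (hp : 0 < p) (ha : 0 < a) (hb : 0 < b) {β : ℝ} (hβ : 0 < β) {X : ℝ → ℝ} {t₁ t₂ : ℝ}
    (ht₁ : 0 < t₁) (hX : ContinuousOn X (Icc t₁ t₂)) :
    ContinuousOn (fun t => shiftMass β a b UL UR (X t) t) (Icc t₁ t₂) := by
  obtain ⟨C, hC0, hC⟩ := h.exists_linear_growth hp ht₁ t₂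
  obtain ⟨R, hR⟩ := isCompact_Icc.exists_bound_of_continuousOn hX
  have hgc := continuous_logisticDeriv ha hb (β := β)
  -- With `|X| ≤ |R|` on the interval, the potential difference at `y + X t` is at most `C (1 + |R|
  -- + |y|)`, which dominates for all times at once.
  have hi := (integrable_of_linear_growth ha hb hβ (D := fun y => C * (1 + (|R| + |y|)))
    (C := C * (1 + |R|)) (by fun_prop) (fun y => by
      rw [abs_of_nonneg (by positivity), mul_assoc]
      refine mul_le_mul_of_nonneg_left ?_ hC0
      nlinarith [abs_nonneg R, abs_nonneg y, mul_nonneg (abs_nonneg R) (abs_nonneg y)]) 0).norm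
  simp only [sub_zero] at hi
  refine continuousOn_of_dominated (fun t ht => ?_) (fun t ht => ?_) hi ?_
  · exact (h.integrable_shift hp ha hb hβ (ht₁.trans_le ht.1) (X t)).aestronglyMeasurable
  · refine Eventually.of_forall fun y => ?_
    rw [norm_mul, norm_mul]
    refine mul_le_mul_of_nonneg_right ((hC _ t ht.1 ht.2).trans ?_) (norm_nonneg _)
    refine le_trans (mul_le_mul_of_nonneg_left ?_ hC0) (le_abs_self _)
    have h1 := abs_add_le y (X t)
    have h2 := (hR t ht).trans (le_abs_self R)
    rw [Real.norm_eq_abs] at h2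
    linarith
  · refine Eventually.of_forall fun y => ContinuousOn.mul ?_ continuousOn_const
    exact h.continuousOn_sub.comp (f := fun t => (y + X t, t))
      ((continuousOn_const.add hX).prodMk continuousOn_id) fun t ht => ht₁.trans_le ht.1

/-- At the resonant times the shift function follows the shock. -/
theorem IsShockTriple.shift_eq (hν : 0 < ν) (hu : ur < ul) (hp : 0 < p) (ha : 0 < a) (hb : 0 < b)
    (h : IsShockTriple ν ul ur p a b u uL uR U UL UR)
    (hL : IsBoundedSolution burgersFlux ν u₀L uL) (hR : IsBoundedSolution burgersFlux ν u₀R uR)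
    {g : ℝ → ℝ} (hg : ∀ x, g x = logistic a b ((ul - ur) / (2 * ν) * x)) {T₀ : ℝ} {X : ℝ → ℝ}
    (hT : IsAdmissibleTime ul ur uL uR T₀)
    (hX : IsShiftFunction burgersFlux ν u uL uR g T₀ X) {t : ℝ} (ht : T₀ ≤ t) {k : ℕ}
    (hk : k * p = (ul - ur) * t) : X t = shockSpeed burgersFlux ul ur * t := by
  have hT0 := hT.1
  have ht0 : 0 < t := hT0.trans_le ht
  have hc : 0 < ul - ur := by linarith
  set β := (ul - ur) / (2 * ν) with hβ_def
  have hβ : 0 < β := div_pos hc (by positivity)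
  have hg' : g = fun x => logistic a b (β * x) := funext hg
  have hcu : ∀ {τ}, 0 < τ → Continuous (fun x => uL x τ - uR x τ) := fun hτ =>
    (continuous_slice hL.continuousOn hτ).sub (continuous_slice hR.continuousOn hτ)
  obtain ⟨M₁, hM₁⟩ := hL.bounded
  obtain ⟨M₂, hM₂⟩ := hR.bounded
  have hM : ∀ {τ}, 0 < τ → ∀ x, |uL x τ - uR x τ| ≤ M₁ + M₂ := fun hτ x =>
    (abs_sub _ _).trans (add_le_add (hM₁ x _ hτ) (hM₂ x _ hτ))
  have hmass : ∀ {τ}, 0 < τ → ∀ ξ, ∫ x, (u x τ - ansatz uL uR g ξ x τ)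
      = 2 * ν * Real.log a - 2 * ν * Real.log b + shiftMass β a b UL UR ξ τ := fun hτ ξ =>
    h.integral_sub_ansatz hν hu hp ha hb hτ (hcu hτ) (hM hτ) hg ξ
  have hconst : shiftMass β a b UL UR (X t) t = shiftMass β a b UL UR (X T₀) T₀ := by
    rcases eq_or_lt_of_le ht with rfl | hlt
    · rfl
    -- The shift equation holds only for `t > T₀`; the mean value theorem needs just continuity at
    -- `T₀`.
    obtain ⟨τ, -, hτ⟩ := exists_hasDerivAt_eq_slope
      (fun t => shiftMass β a b UL UR (X t) t) (fun _ => 0) hlt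
      (h.continuousOn_shiftMass hp ha hb hβ hT0 (hX.continuousOn.mono Icc_subset_Ici_self))
      (fun τ hτ => h.hasDerivAt_shiftMass_zero hL hR hp ha hb hβ (hT0.trans hτ.1) (half_pos hc)
        (fun x => (hT.2 x τ hτ.1.le).1.le) (by rw [← hg']; exact hX.equation τ hτ.1))
    rw [eq_div_iff (by linarith), zero_mul] at hτ
    linarith
  have h1 : 2 * ν * Real.log a - 2 * ν * Real.log b + shiftMass β a b UL UR (X t) t = 0 := by
    rw [hconst, ← hmass hT0, hX.zero_mass]
  have h2 : 2 * ν * Real.log a - 2 * ν * Real.log b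
      + shiftMass β a b UL UR (shockSpeed burgersFlux ul ur * t) t = 0 := by
    rw [← hmass ht0]
    simp [h.eq_ansatz hν hu ha hb hg ht0 hk]
  -- At a resonant time `UL - UR` is affine in `x` with slope `ul - ur`, so the mass is affine in
  -- `ξ` with slope `ul - ur` times `∫ g' = -1`.
  have h3 : shiftMass β a b UL UR (X t) t
      - shiftMass β a b UL UR (shockSpeed burgersFlux ul ur * t) t
      = -((ul - ur) * (X t - shockSpeed burgersFlux ul ur * t)) := by
    rw [shiftMass, shiftMass, ← integral_sub (h.integrable_shift hp ha hb hβ ht0 _)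
      (h.integrable_shift hp ha hb hβ ht0 _)]
    simp only [h.sub_eq_of_resonant hu ht0.le hk]
    rw [← mul_neg_one, ← integral_logisticDeriv ha hb hβ, ← integral_const_mul]
    congr 1
    ext y
    ring
  have h4 : (ul - ur) * (X t - shockSpeed burgersFlux ul ur * t) = 0 := by linarith
  rcases mul_eq_zero.1 h4 with h5 | h5 <;> linarith

end Shift

end ViscousLaw

/-! ### Conclusion -/

theorem mainTheorem5 (ν ul ur p : ℝ) (hν : 0 < ν) (hu : ur < ul) (hp : 0 < p)
    (φ : ℝ → ℝ) (hφ : ViscousLaw.IsShockProfile ViscousLaw.burgersFlux 1 ul ur φ)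
    (w₀ : ℝ → ℝ) (hw : MemLp w₀ ⊤ volume) (hper : Function.Periodic w₀ p)
    (havg : (1 / p) * ∫ x in (0 : ℝ)..p, w₀ x = 0)
    (u uL uR : ℝ → ℝ → ℝ)
    (hsol : ViscousLaw.IsBoundedSolution ViscousLaw.burgersFlux ν
      (fun x => ViscousLaw.scaledProfile φ ν x + w₀ x) u)
    (hL : ViscousLaw.IsBoundedSolution ViscousLaw.burgersFlux ν (fun x => ul + w₀ x) uL)
    (hR : ViscousLaw.IsBoundedSolution ViscousLaw.burgersFlux ν (fun x => ur + w₀ x) uR) :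
    (∀ k : ℕ, ∀ x : ℝ,
      u x (k * p / (ul - ur)) =
        ViscousLaw.ansatz uL uR (ViscousLaw.weight φ ν ul ur)
          (ViscousLaw.shockSpeed ViscousLaw.burgersFlux ul ur * (k * p / (ul - ur)))
          x (k * p / (ul - ur))) ∧
    (∀ (T₀ : ℝ) (X : ℝ → ℝ),
      ViscousLaw.IsAdmissibleTime ul ur uL uR T₀ →
      ViscousLaw.IsShiftFunction ViscousLaw.burgersFlux ν u uL uR
        (ViscousLaw.weight φ ν ul ur) T₀ X →
      ∀ k : ℕ, T₀ ≤ k * p / (ul - ur) →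
        X (k * p / (ul - ur)) =
          ViscousLaw.shockSpeed ViscousLaw.burgersFlux ul ur * (k * p / (ul - ur))) := by
  have hc : 0 < ul - ur := by linarith
  have havg' : ∫ x in (0 : ℝ)..p, w₀ x = 0 :=
    (mul_eq_zero.1 havg).resolve_left (one_div_ne_zero hp.ne')
  obtain ⟨a, b, ha, hb, hg, U, UL, UR, h⟩ :=
    ViscousLaw.exists_isShockTriple hν hu hφ hw hper havg' hsol hL hR
  have hres : ∀ k : ℕ, (k : ℝ) * p = (ul - ur) * (k * p / (ul - ur)) := fun k =>
    (mul_div_cancel₀ _ hc.ne').symm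
  refine ⟨fun k x => ?_, fun T₀ X hT hX k hk =>
    h.shift_eq hν hu hp ha hb hL hR hg hT hX hk (hres k)⟩
  -- The Cole-Hopf argument needs `t > 0`. At `t = 0` the prescribed values reduce the claim to the
  -- definition of the weight.
  rcases Nat.eq_zero_or_pos k with rfl | hk
  · simp only [Nat.cast_zero, zero_mul, zero_div, mul_zero, ViscousLaw.ansatz, sub_zero,
      ViscousLaw.weight]
    rw [hsol.initial_value, hL.initial_value, hR.initial_value]
    field_simp
    ring
  · have ht : (0 : ℝ) < k * p / (ul - ur) := by positivity
    exact h.eq_ansatz hν hu ha hb hg ht (hres k) x
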